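/- \textbf{Conventions.} Let $\mathcal A$ be a finite linearly ordered alphabet and $k$ a field. A language $L$ over $\mathcal A$ is \emph{factorial} if every subword (contiguous factor) of a word of $L$ belongs to $L$; $T_L(n)$ is the number of words of length $n$ in $L$; $L$ is \emph{boundary} if there is a constant $C$ with $T_L(n)\le n+C$ for all $n$. For an associative unital $k$-algebra $A$ generated by elements $a_x$ ($x\in\mathcal A$), $V_A(n)$ is the dimension of the span of the monomials (products of generators) of length at most $n$, and $T_A(n)=V_A(n)-V_A(n-1)$ (with $V_A(-1)=0$); $A$ is \emph{boundary} if $T_A(n)-n<\mathrm{const}$. A word is \emph{normal} in $A$ if its monomial is not a linear combination of monomials of smaller words, where words are compared first by length and then lexicographically. A \emph{superword} is a right-infinite, left-infinite or two-sided infinite word. It is \emph{recurrent} if each of its finite subwords occurs in it infinitely often (in both directions in the two-sided case), and \emph{uniformly recurrent} if moreover for each finite subword $v$ there is $N(v)$ such that every subword of length at least $N(v)$ contains $v$. $L$ contains a superword if it contains all its finite subwords. Two superwords are \emph{equivalent} if they have the same finite subwords. An \emph{obstruction for} a superword $W$ is a finite word that is not a subword of $W$ but all of whose proper subwords are subwords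 of $W$. $u^{\infty/2}$ is the one-sided infinite and $u^{\infty}$ the two-sided infinite repetition of a nonempty word $u$, and $T_W(n)$ is the number of subwords of $W$ of length $n$. \textbf{Theorem.} Let $L$ be a boundary factorial language over $\mathcal A$. Then $L$ is the set of normal words of some boundary $k$-algebra with generators $a_x$, $x\in\mathcal A$. Moreover, $L$ is described as follows. \textbf{Case 1.} Suppose that $L$ contains no uniformly recurrent nonperiodic superword. If $T_L$ is unbounded, then $L$ is the set of all finite subwords of a family of words that consists of \begin{enumerate} \item one word $W=u^{\infty/2}cv^{\infty/2}\ne u^\infty$; \item a finite set of finite words; \item words $u_i^{\infty/2}c_i$, $i=1,\dots,r_1$; \item words $d_iv_i^{\infty/2}$, $i=1,\dots,r_2$; \item words $e_jR_j^{k}f_j$, $k\in\mathbb K_j\subseteq\mathbb N$, $j=1,\dots,r_3$; \item a set of words $W_\alpha=E_\alpha u^{n_\alpha}cv^{m_\alpha}F_\alpha$, with $u,c,v$ as in (1), for which $|E_\alpha|+|F_\alpha|$ is bounded and there is a constant $b$ such that for every $k$ the number of words $W_\alpha$ of length $k$ is less than $b$. \end{enumerate} If $T_L$ is bounded, then $L$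 is the set of all finite subwords of a family of words of the types (2)--(5) alone. (Any of the sets (2)--(6) may be empty.) \textbf{Case 2.} Suppose that $L$ contains a uniformly recurrent nonperiodic superword $W$. Then $T_W(n)=n+\mathrm{const}$ for all sufficiently large $n$, and $L$ is the set of all finite subwords of a family of words that consists of \begin{enumerate} \item the word $W$; \item[(2)--(5)] sets of words as in (2)--(5) of Case 1; \item[(6)] words $L_iO_iW_i$, $i=1,\dots,k_1$, where $W_i$ is a right-infinite word equivalent to $W$, $O_i$ is an obstruction for $W$, and the initial $O_i$ is the only occurrence of an obstruction for $W$ in $O_iW_i$; \item[(7)] words $W'_jO'_jL'_j$, $j=1,\dots,k_2$, where $W'_j$ is a left-infinite word equivalent to $W$, $O'_j$ is an obstruction for $W$, and the final $O'_j$ is the only occurrence of an obstruction for $W$ in $W'_jO'_j$; \item[(8)] finitely many series of words $h^1_iTh^2_i$, $T\in\mathcal T_i$, $i=1,\dots,s$ (the $\mathcal T_i$ being sets of finite words), such that (a) every $T\in\mathcal T_i$ contains one or two occurrences of obstructions for $W$ (two occurrences may overlap); (b) there is a constant $c>0$ with $|h^1_i|+|h^2_i|<c$ for all $i$; (c) there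 is $m>0$ such that for every $k$ at most $m$ words of length $k$ are subwords of words of the form (8) without being subwords of $W$. \end{enumerate} -/

import Mathlib

universe u v

namespace BoundaryLang

/-! ### Words, languages, growth -/

section Words

variable {α : Type v}

/-- The growth function `T_L(n)`: the number of words of length `n` in `L`. -/
noncomputable def growth (L : Set (List α)) (n : ℕ) : ℕ :=
  {w | w ∈ L ∧ w.length = n}.ncard

/-- A language is factorial if it is closed under subwords (contiguous factors). -/
def IsFactorial (L : Set (List α)) : Prop :=
  ∀ w ∈ L, ∀ v : List α, v <:+: w → v ∈ L

/-- A language is boundary if `T_L(n) ≤ n + const`. -/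
def IsBoundary (L : Set (List α)) : Prop :=
  ∃ C : ℕ, ∀ n : ℕ, growth L n ≤ n + C

/-- The growth function of `L` is bounded. -/
def HasBoundedGrowth (L : Set (List α)) : Prop :=
  ∃ B : ℕ, ∀ n : ℕ, growth L n ≤ B

/-- The word `x p, x (p+1), …, x (p+n-1)`. -/
def window (x : ℕ → α) (p n : ℕ) : List α :=
  List.ofFn fun i : Fin n => x (p + i)

/-- The word `x p, x (p+1), …, x (p+n-1)` of a two-sided sequence. -/
def windowZ (x : ℤ → α) (p : ℤ) (n : ℕ) : List α :=
  List.ofFn fun i : Fin n => x (p + (i : ℕ))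

/-- The sequence `l` followed by `x`. -/
def prepend (l : List α) (x : ℕ → α) : ℕ → α :=
  fun i => if h : i < l.length then l[i] else x (i - l.length)

/-- The sequence `u u u …`. -/
def repeatWord (u : List α) (hu : u ≠ []) : ℕ → α :=
  fun i => u[i % u.length]'(Nat.mod_lt _ (List.length_pos_iff.2 hu))

/-- The two-sided sequence `… l 2, l 1, l 0, r 0, r 1, r 2, …`, with `r 0` at the position `0`. -/
def glue (l r : ℕ → α) : ℤ → α
  | Int.ofNat n => r n
  | Int.negSucc n => l n

/-- Finite words, and superwords of the three kinds. The sequence `x` in `left x` is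
read from right to left: `left x` is the left-infinite word `… x 2, x 1, x 0`. -/
inductive GWord (α : Type v) : Type v
  | fin (w : List α) : GWord α
  | right (x : ℕ → α) : GWord α
  | left (x : ℕ → α) : GWord α
  | two (x : ℤ → α) : GWord α

/-- The right-infinite word `l x`. -/
def GWord.finRight (l : List α) (x : ℕ → α) : GWord α := .right (prepend l x)

/-- The left-infinite word `x l`, where `x` is the left-infinite word `… x 2, x 1, x 0`. -/
def GWord.leftFin (x : ℕ → α) (l : List α) : GWord α := .left (prepend l.reverse x)

/-- The left-infinite word `… u u u`, as a sequence read from right to left. -/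
def repeatLeft (u : List α) (hu : u ≠ []) : ℕ → α :=
  repeatWord u.reverse (by simpa using hu)

/-- The two-sided word `u^{∞/2} c v^{∞/2} = … u u u c v v v …`. -/
def twoTails (u c v : List α) (hu : u ≠ []) (hv : v ≠ []) : ℤ → α :=
  glue (repeatLeft u hu) (prepend c (repeatWord v hv))

/-- The two-sided periodic word `u^∞ = … u u u u …`. -/
def twoPeriodic (u : List α) (hu : u ≠ []) : ℤ → α :=
  glue (repeatLeft u hu) (repeatWord u hu)

/-- The set of all finite subwords. -/
def GWord.factors : GWord α → Set (List α)
  | .fin w => {v | v <:+: w}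
  | .right x => {v | ∃ p n : ℕ, v = window x p n}
  | .left x => {v | ∃ p n : ℕ, v = (window x p n).reverse}
  | .two x => {v | ∃ (p : ℤ) (n : ℕ), v = windowZ x p n}

/-- The set of all finite subwords of the members of a family of words. -/
def factorsOf (S : Set (GWord α)) : Set (List α) :=
  {w | ∃ X ∈ S, w ∈ X.factors}

/-- A recurrent superword: every subword occurs infinitely often (in both directions,
if the superword is two-sided). Finite words are not recurrent. -/
def GWord.IsRecurrent : GWord α → Prop
  | .fin _ => False
  | .right x => ∀ v ∈ (GWord.right x).factors, ∀ N : ℕ, ∃ p ≥ N, window x p v.length = v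
  | .left x => ∀ v ∈ (GWord.left x).factors, ∀ N : ℕ, ∃ p ≥ N, (window x p v.length).reverse = v
  | .two x => ∀ v ∈ (GWord.two x).factors, ∀ N : ℤ,
      (∃ p ≥ N, windowZ x p v.length = v) ∧ (∃ p ≤ N, windowZ x p v.length = v)

/-- A uniformly recurrent superword. -/
def GWord.IsUniformlyRecurrent (W : GWord α) : Prop :=
  W.IsRecurrent ∧
    ∀ v ∈ W.factors, ∃ N : ℕ, ∀ w ∈ W.factors, N ≤ w.length → v <:+: w

/-- A periodic superword. -/
def GWord.IsPeriodic : GWord α → Prop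
  | .fin _ => False
  | .right x => ∃ d : ℕ, 0 < d ∧ ∀ i, x (i + d) = x i
  | .left x => ∃ d : ℕ, 0 < d ∧ ∀ i, x (i + d) = x i
  | .two x => ∃ d : ℕ, 0 < d ∧ ∀ i, x (i + d) = x i

/-- `W` is a uniformly recurrent nonperiodic superword of the language `L`. -/
def IsURNonperiodicIn (W : GWord α) (L : Set (List α)) : Prop :=
  W.IsUniformlyRecurrent ∧ ¬ W.IsPeriodic ∧ W.factors ⊆ L

/-- An obstruction for a factorial language `F`: a word outside `F` all of whose proper
subwords are in `F`. -/
def IsObstruction (F : Set (List α)) (o : List α) : Prop :=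
  o ∉ F ∧ ∀ v : List α, v <:+: o → v ≠ o → v ∈ F

/-- The occurrences (position, length) of obstructions for `F` in the finite word `t`. -/
def obstructionOccurrences (F : Set (List α)) (t : List α) : Set (ℕ × ℕ) :=
  {q | q.1 + q.2 ≤ t.length ∧ IsObstruction F ((t.drop q.1).take q.2)}

/-- The power `R^k`. -/
def wordPow (R : List α) (k : ℕ) : List α := (List.replicate k R).flatten

/-! ### The families of words in the description -/

/-- A finite set of finite words. -/
def IsFiniteFamily (S : Set (GWord α)) : Prop :=
  ∃ μ : Set (List α), μ.Finite ∧ S = GWord.fin '' μ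

/-- A finite set of words `u_i^{∞/2} c_i`. -/
def IsLeftPeriodicFamily (S : Set (GWord α)) : Prop :=
  ∃ (r : ℕ) (u c : Fin r → List α) (hu : ∀ i, u i ≠ []),
    S = Set.range fun i => GWord.leftFin (repeatLeft (u i) (hu i)) (c i)

/-- A finite set of words `d_i v_i^{∞/2}`. -/
def IsRightPeriodicFamily (S : Set (GWord α)) : Prop :=
  ∃ (r : ℕ) (d v : Fin r → List α) (hv : ∀ i, v i ≠ []),
    S = Set.range fun i => GWord.finRight (d i) (repeatWord (v i) (hv i))

/-- Finitely many series `e_j R_j^k f_j`, `k ∈ K_j`. -/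
def IsPowerFamily (S : Set (GWord α)) : Prop :=
  ∃ (r : ℕ) (e R f : Fin r → List α) (K : Fin r → Set ℕ), (∀ j, R j ≠ []) ∧
    S = {X | ∃ j, ∃ k ∈ K j, X = GWord.fin (e j ++ wordPow (R j) k ++ f j)}

/-- A set of words `E u^n c v^m F`, with `|E| + |F|` bounded and boundedly many words of
each length. -/
def IsTwoPowerFamily (u c v : List α) (S : Set (GWord α)) : Prop :=
  ∃ P : Set (List α × ℕ × ℕ × List α),
    S = (fun q => GWord.fin (q.1 ++ wordPow u q.2.1 ++ c ++ wordPow v q.2.2.1 ++ q.2.2.2)) '' P ∧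
    (∃ b : ℕ, ∀ q ∈ P, q.1.length + q.2.2.2.length < b) ∧
    ∃ b : ℕ, ∀ k : ℕ, {w : List α | GWord.fin w ∈ S ∧ w.length = k}.ncard < b

/-- A finite set of words `L_i O_i W_i`, where `W_i` is a right-infinite word with the same
subwords as `W`, `O_i` is an obstruction for `W`, and the initial `O_i` is the only occurrence
of an obstruction for `W` in `O_i W_i`. -/
def IsRightTailFamily (W : GWord α) (S : Set (GWord α)) : Prop :=
  ∃ (r : ℕ) (l o : Fin r → List α) (x : Fin r → ℕ → α),
    (∀ i, IsObstruction W.factors (o i) ∧ (GWord.right (x i)).factors = W.factors ∧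
      ∀ p n : ℕ, IsObstruction W.factors (window (prepend (o i) (x i)) p n) →
        p = 0 ∧ n = (o i).length) ∧
    S = Set.range fun i => GWord.finRight (l i ++ o i) (x i)

/-- A finite set of words `W'_j O'_j L'_j`, where `W'_j` is a left-infinite word with the same
subwords as `W`, `O'_j` is an obstruction for `W`, and the final `O'_j` is the only occurrence
of an obstruction for `W` in `W'_j O'_j`. -/
def IsLeftTailFamily (W : GWord α) (S : Set (GWord α)) : Prop :=
  ∃ (r : ℕ) (l o : Fin r → List α) (x : Fin r → ℕ → α),
    (∀ j, IsObstruction W.factors (o j) ∧ (GWord.left (x j)).factors = W.factors ∧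
      ∀ p n : ℕ, IsObstruction W.factors (window (prepend (o j).reverse (x j)) p n).reverse →
        p = 0 ∧ n = (o j).length) ∧
    S = Set.range fun j => GWord.leftFin (x j) (o j ++ l j)

/-- Finitely many series of words `h¹_i T h²_i`, `T ∈ 𝒯_i`, where every `T` has one or two
occurrences of obstructions for `W`, the lengths `|h¹_i| + |h²_i|` are bounded, and the number
of subwords of each length that are not subwords of `W` is bounded. -/
def IsTwoObstructionFamily (W : GWord α) (S : Set (GWord α)) : Prop :=
  ∃ (s : ℕ) (h₁ h₂ : Fin s → List α) (T : Fin s → Set (List α)),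
    S = {X | ∃ i, ∃ t ∈ T i, X = GWord.fin (h₁ i ++ t ++ h₂ i)} ∧
    (∀ i, ∀ t ∈ T i, 1 ≤ (obstructionOccurrences W.factors t).ncard ∧
      (obstructionOccurrences W.factors t).ncard ≤ 2) ∧
    (∃ b : ℕ, ∀ i, (h₁ i).length + (h₂ i).length < b) ∧
    ∃ m : ℕ, 0 < m ∧ ∀ k : ℕ,
      {w : List α | w ∈ factorsOf S ∧ w ∉ W.factors ∧ w.length = k}.ncard ≤ m

/-- The description in the absence of a uniformly recurrent nonperiodic superword, for
unbounded growth. -/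
def DescriptionOne (L : Set (List α)) : Prop :=
  ∃ (u c v : List α) (hu : u ≠ []) (hv : v ≠ []) (S₂ S₃ S₄ S₅ S₆ : Set (GWord α)),
    twoTails u c v hu hv ≠ twoPeriodic u hu ∧
    IsFiniteFamily S₂ ∧ IsLeftPeriodicFamily S₃ ∧ IsRightPeriodicFamily S₄ ∧
    IsPowerFamily S₅ ∧ IsTwoPowerFamily u c v S₆ ∧
    L = factorsOf ({GWord.two (twoTails u c v hu hv)} ∪ S₂ ∪ S₃ ∪ S₄ ∪ S₅ ∪ S₆)

/-- The description for bounded growth. -/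
def DescriptionSlow (L : Set (List α)) : Prop :=
  ∃ S₂ S₃ S₄ S₅ : Set (GWord α),
    IsFiniteFamily S₂ ∧ IsLeftPeriodicFamily S₃ ∧ IsRightPeriodicFamily S₄ ∧
    IsPowerFamily S₅ ∧ L = factorsOf (S₂ ∪ S₃ ∪ S₄ ∪ S₅)

/-- The description in the presence of the uniformly recurrent nonperiodic superword `W`. -/
def DescriptionTwo (W : GWord α) (L : Set (List α)) : Prop :=
  (∃ K N : ℕ, ∀ n ≥ N, growth W.factors n = n + K) ∧
  ∃ S₂ S₃ S₄ S₅ S₆ S₇ S₈ : Set (GWord α),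
    IsFiniteFamily S₂ ∧ IsLeftPeriodicFamily S₃ ∧ IsRightPeriodicFamily S₄ ∧
    IsPowerFamily S₅ ∧ IsRightTailFamily W S₆ ∧ IsLeftTailFamily W S₇ ∧
    IsTwoObstructionFamily W S₈ ∧
    L = factorsOf ({W} ∪ S₂ ∪ S₃ ∪ S₄ ∪ S₅ ∪ S₆ ∪ S₇ ∪ S₈)

end Words

/-! ### Algebras with a chosen system of generators -/

section Algebras

variable (𝕜 : Type u) [Field 𝕜] {α : Type v} {A : Type*} [Ring A] [Algebra 𝕜 A]

/-- The monomial (product of generators) spelled by a word. -/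
def monomial (a : α → A) (w : List α) : A := (w.map a).prod

/-- `V_A(n)`: the dimension of the span of the monomials of length at most `n`. -/
noncomputable def algV (a : α → A) (n : ℕ) : ℕ :=
  Module.finrank 𝕜 (Submodule.span 𝕜 (monomial a '' {w | w.length ≤ n}))

/-- `T_A(n) = V_A(n) - V_A(n-1)`, with `V_A(-1) = 0`. -/
noncomputable def algT (a : α → A) : ℕ → ℤ
  | 0 => algV 𝕜 a 0
  | n + 1 => (algV 𝕜 a (n + 1) : ℤ) - algV 𝕜 a n

/-- `A` is a boundary algebra with respect to the generators `a`: the family `a` generates `A`,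
and `T_A(n) - n < const`. -/
def IsBoundaryAlgebra (a : α → A) : Prop :=
  Algebra.adjoin 𝕜 (Set.range a) = ⊤ ∧ ∃ C : ℤ, ∀ n : ℕ, algT 𝕜 a n - n < C

/-- The normal words: those whose monomial is not a linear combination of monomials of smaller
words. Words are compared by length first and then lexicographically. -/
def normalWords [LinearOrder α] (a : α → A) : Set (List α) :=
  {w | monomial a w ∉ Submodule.span 𝕜 (monomial a '' {v | List.Shortlex (· < ·) v w})}

end Algebras

end BoundaryLang

/-! The algebra is the monomial algebra of `L`, realized by left concatenation on the space with
basis `L`. Words outside `L` act as zero and those of `L` act independently, so `L` is the set of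
normal words and `T_A` is `T_L`.

For the description, let `F` be the set of subwords of a superword `W` of `L` that is nonperiodic
and either two-sided or recurrent. By a Morse–Hedlund argument (`growth_lt_succ`) `T_W` is strictly
increasing, so `T_W(n) ≥ n` and at most `C` words of each length lie in `L` but not in `F`. Strip
`C` letters from both ends of a long word `w` of `L`. If the middle is not in `F`, pigeonhole makes
`w` a power up to bounded ends (`isBoundedPower_of_ncard_le`). Otherwise `w` is a word of `F` with
bounded extensions: in Case 2 it can be recut around a factor with exactly one obstruction
(`exists_one_obstruction`), and in Case 1 it inherits the form `u^n c v^m`. For bounded growth the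
same pigeonhole works with `F = ∅`. Each word of `L` outside `F` is itself put into a family, so the
families of one-sided infinite words can be taken empty.

It remains, in Case 1, to find `u^{∞/2} c v^{∞/2}` in `L`. Unbounded growth gives two points of `L`
that agree on the negative half-line and differ at 0. The language of that half-line contains a
uniformly recurrent sequence, periodic by hypothesis, so long periodic runs occur there; each must
break in one of the two points. Recentering at the break and passing to a limit gives a point `y`,
periodic to the left with a break at 0, and reversal gives a point `q`, periodic to the right with a
break. The windows of length `n` of `y` and of `q` that see the break number about `n` each, while
`L` has only `n + C` words; hence long windows coincide, and `y` inherits the right period of `q`.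
-/

namespace BoundaryLang

/-! ### The monomial algebra of a factorial language -/

section MonomialAlgebra

universe w

variable (𝕜 : Type u) [Field 𝕜] {α : Type v}

lemma finite_words_length_eq [Finite α] (P : List α → Prop) (n : ℕ) :
    {w : List α | P w ∧ w.length = n}.Finite :=
  (List.finite_length_eq α n).subset fun _ h => h.2

lemma finite_words_length_le [Finite α] (P : List α → Prop) (n : ℕ) :
    {w : List α | P w ∧ w.length ≤ n}.Finite :=
  (List.finite_length_le α n).subset fun _ h => h.2

/-- The operator on the span of `L` that puts the letter `x` in front of a word. -/
noncomputable def consEnd (L : Set (List α)) (x : α) : Module.End 𝕜 (L →₀ 𝕜) :=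
  open Classical in
  Finsupp.linearCombination 𝕜 fun w : L =>
    if h : x :: w.1 ∈ L then Finsupp.single (⟨x :: w.1, h⟩ : L) (1 : 𝕜) else 0

open Classical in
lemma monomial_consEnd_single {L : Set (List α)} (hL : IsFactorial L) (w : List α) (v : L) :
    monomial (consEnd 𝕜 L) w (Finsupp.single v 1) =
      if h : w ++ v.1 ∈ L then Finsupp.single (⟨w ++ v.1, h⟩ : L) (1 : 𝕜) else 0 := by
  induction w with
  | nil => simp [monomial]
  | cons x w ih =>
    have hm : monomial (consEnd 𝕜 L) (x :: w) = consEnd 𝕜 L x * monomial (consEnd 𝕜 L) w := by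
      simp [monomial]
    rw [hm, Module.End.mul_apply, ih]
    by_cases h : w ++ v.1 ∈ L
    · simp [h, consEnd]
    · have h' : x :: (w ++ v.1) ∉ L := fun h' =>
        h (hL _ h' _ ⟨[x], [], by simp⟩)
      simp [h, h']

lemma monomial_consEnd_eq_zero {L : Set (List α)} (hL : IsFactorial L) {w : List α} (hw : w ∉ L) :
    monomial (consEnd 𝕜 L) w = 0 := by
  classical
  refine Finsupp.lhom_ext' fun v => LinearMap.ext_ring ?_
  have : w ++ v.1 ∉ L := fun h => hw (hL _ h _ ⟨[], v.1, by simp⟩)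
  simp [monomial_consEnd_single 𝕜 hL, this]

/-- Evaluation at the empty word sends the monomial of `w` to the basis vector `w`. -/
lemma linearIndependent_monomial_consEnd {L : Set (List α)} (hL : IsFactorial L) :
    LinearIndependent 𝕜 fun w : L => monomial (consEnd 𝕜 L) w.1 := by
  classical
  rcases isEmpty_or_nonempty L with h | ⟨⟨w₀, h₀⟩⟩
  · exact linearIndependent_empty_type
  have hnil : [] ∈ L := hL _ h₀ _ (List.nil_infix)
  refine LinearIndependent.of_comp
    (LinearMap.applyₗ (Finsupp.single (⟨[], hnil⟩ : L) (1 : 𝕜)) :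
      Module.End 𝕜 (L →₀ 𝕜) →ₗ[𝕜] (L →₀ 𝕜)) ?_
  convert Finsupp.linearIndependent_single_one 𝕜 L using 1
  ext1 w
  simp [monomial_consEnd_single 𝕜 hL]

variable {𝕜} {A : Type*} [Ring A] [Algebra 𝕜 A] {a : α → A} {L : Set (List α)}

/-- The order matters only through irreflexivity: smaller words contribute zero or other members of
an independent family. -/
lemma normalWords_eq [LinearOrder α] (h0 : ∀ w ∉ L, monomial a w = 0)
    (hli : LinearIndependent 𝕜 fun w : L => monomial a w.1) : normalWords 𝕜 a = L := by
  ext w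
  constructor
  · intro h
    by_contra hw
    apply h
    rw [h0 w hw]
    exact Submodule.zero_mem _
  · intro hw h
    have hnot : (⟨w, hw⟩ : L) ∉ {v : L | List.Shortlex (· < ·) v.1 w} := fun h' => by
      have := List.shortlex_def.1 h'
      simp at this
    refine hli.notMem_span_image hnot (Submodule.span_le.2 ?_ h)
    rintro _ ⟨v, hv, rfl⟩
    by_cases hvL : v ∈ L
    · exact Submodule.subset_span ⟨⟨v, hvL⟩, hv, rfl⟩
    · rw [h0 v hvL]
      exact Submodule.zero_mem _

lemma algV_eq [Finite α] (h0 : ∀ w ∉ L, monomial a w = 0)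
    (hli : LinearIndependent 𝕜 fun w : L => monomial a w.1) (n : ℕ) :
    algV 𝕜 a n = {w | w ∈ L ∧ w.length ≤ n}.ncard := by
  have hfin := finite_words_length_le (· ∈ L) n
  have : Fintype {w | w ∈ L ∧ w.length ≤ n} := hfin.fintype
  have hli' : LinearIndependent 𝕜 fun w : {w | w ∈ L ∧ w.length ≤ n} => monomial a w.1 :=
    hli.comp (fun w : {w | w ∈ L ∧ w.length ≤ n} => (⟨w.1, w.2.1⟩ : L)) fun w w' h => by
      simpa [Subtype.ext_iff] using h
  have hspan : Submodule.span 𝕜 (monomial a '' {w | w.length ≤ n}) =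
      Submodule.span 𝕜 (Set.range fun w : {w | w ∈ L ∧ w.length ≤ n} => monomial a w.1) := by
    apply le_antisymm
    · refine Submodule.span_le.2 ?_
      rintro _ ⟨v, hv, rfl⟩
      by_cases hvL : v ∈ L
      · exact Submodule.subset_span ⟨⟨v, hvL, hv⟩, rfl⟩
      · rw [h0 v hvL]
        exact Submodule.zero_mem _
    · refine Submodule.span_mono ?_
      rintro _ ⟨v, rfl⟩
      exact ⟨v.1, v.2.2, rfl⟩
  rw [algV, hspan, finrank_span_eq_card hli', ← Nat.card_eq_fintype_card, Nat.card_coe_set_eq]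

lemma algT_eq [Finite α] (h0 : ∀ w ∉ L, monomial a w = 0)
    (hli : LinearIndependent 𝕜 fun w : L => monomial a w.1) (n : ℕ) :
    algT 𝕜 a n = growth L n := by
  cases n with
  | zero =>
    simp only [algT, algV_eq h0 hli, growth]
    congr 2
    ext w
    simp
  | succ n =>
    have hsplit : {w | w ∈ L ∧ w.length ≤ n + 1} =
        {w | w ∈ L ∧ w.length ≤ n} ∪ {w | w ∈ L ∧ w.length = n + 1} := by
      ext w
      simp only [Set.mem_ofPred_eq, Set.mem_union]
      constructor
      · rintro ⟨h, h'⟩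
        rcases Nat.lt_or_ge n w.length with h2 | h2
        · exact Or.inr ⟨h, by omega⟩
        · exact Or.inl ⟨h, h2⟩
      · rintro (⟨h, h'⟩ | ⟨h, h'⟩) <;> exact ⟨h, by omega⟩
    have hdisj : Disjoint {w | w ∈ L ∧ w.length ≤ n} {w | w ∈ L ∧ w.length = n + 1} := by
      rw [Set.disjoint_left]
      rintro w ⟨-, h⟩ ⟨-, h'⟩
      omega
    simp only [algT, algV_eq h0 hli, growth]
    rw [hsplit, Set.ncard_union_eq hdisj (finite_words_length_le _ n)
      (finite_words_length_eq _ (n + 1))]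
    push_cast
    ring

/-- The ambient algebra may be larger than what the generators generate, so it is replaced by the
subalgebra they generate; vanishing and independence of monomials are detected through the
inclusion. -/
lemma exists_boundary_algebra_of_monomial [Finite α] [LinearOrder α] {B : Type w} [Ring B]
    [Algebra 𝕜 B] {a : α → B} (hT : IsBoundary L) (h0 : ∀ w ∉ L, monomial a w = 0)
    (hli : LinearIndependent 𝕜 fun w : L => monomial a w.1) :
    ∃ (A : Type w) (_ : Ring A) (_ : Algebra 𝕜 A) (b : α → A),
      IsBoundaryAlgebra 𝕜 b ∧ normalWords 𝕜 b = L := by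
  let b : α → Algebra.adjoin 𝕜 (Set.range a) := fun x => ⟨a x, Algebra.subset_adjoin ⟨x, rfl⟩⟩
  have hmon : ∀ w, (Algebra.adjoin 𝕜 (Set.range a)).val (monomial b w) = monomial a w :=
    fun w => by
      rw [monomial, monomial, map_list_prod, List.map_map]
      rfl
  have h0' : ∀ w ∉ L, monomial b w = 0 := fun w hw =>
    Subtype.val_injective ((hmon w).trans (h0 w hw))
  have hli' : LinearIndependent 𝕜 fun w : L => monomial b w.1 := by
    refine LinearIndependent.of_comp (Algebra.adjoin 𝕜 (Set.range a)).val.toLinearMap ?_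
    convert hli using 1
    ext1 w
    exact hmon w
  refine ⟨_, inferInstance, inferInstance, b, ⟨?_, ?_⟩, normalWords_eq h0' hli'⟩
  · rw [← Algebra.adjoin_adjoin_coe_preimage (R := 𝕜) (s := Set.range a)]
    congr 1
    ext ⟨y, hy⟩
    simp [b, Subtype.ext_iff]
  · obtain ⟨C, hC⟩ := hT
    refine ⟨C + 1, fun n => ?_⟩
    rw [algT_eq h0' hli']
    have := hC n
    omega

variable (𝕜) in
theorem exists_boundary_algebra [Finite α] [LinearOrder α] (hL : IsFactorial L)
    (hT : IsBoundary L) :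
    ∃ (A : Type (max u v)) (_ : Ring A) (_ : Algebra 𝕜 A) (a : α → A),
      IsBoundaryAlgebra 𝕜 a ∧ normalWords 𝕜 a = L :=
  exists_boundary_algebra_of_monomial (a := consEnd 𝕜 L) hT
    (fun _ => monomial_consEnd_eq_zero 𝕜 hL) (linearIndependent_monomial_consEnd 𝕜 hL)

end MonomialAlgebra

/-! ### Windows of sequences -/

section Windows

variable {α : Type v}

@[simp] lemma length_window (x : ℕ → α) (p n : ℕ) : (window x p n).length = n := by
  simp [window]

@[simp] lemma length_windowZ (x : ℤ → α) (p : ℤ) (n : ℕ) : (windowZ x p n).length = n := by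
  simp [windowZ]

@[simp] lemma getElem_window (x : ℕ → α) (p n i : ℕ) (h : i < (window x p n).length) :
    (window x p n)[i] = x (p + i) := by
  simp [window]

@[simp] lemma getElem_windowZ (x : ℤ → α) (p : ℤ) (n i : ℕ) (h : i < (windowZ x p n).length) :
    (windowZ x p n)[i] = x (p + i) := by
  simp [windowZ]

lemma window_eq_window_iff {x y : ℕ → α} {p q n : ℕ} :
    window x p n = window y q n ↔ ∀ i < n, x (p + i) = y (q + i) := by
  constructor
  · intro h i hi
    have := List.getElem_of_eq h (i := i) (by simpa)
    simpa using this
  · intro h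
    refine List.ext_getElem (by simp) fun i h1 _ => ?_
    simpa using h i (by simpa using h1)

lemma windowZ_eq_windowZ_iff {x y : ℤ → α} {p q : ℤ} {n : ℕ} :
    windowZ x p n = windowZ y q n ↔ ∀ i : ℕ, i < n → x (p + i) = y (q + i) := by
  constructor
  · intro h i hi
    have := List.getElem_of_eq h (i := i) (by simpa)
    simpa using this
  · intro h
    refine List.ext_getElem (by simp) fun i h1 _ => ?_
    simpa using h i (by simpa using h1)

lemma isInfix_iff_take_drop {v w : List α} :
    v <:+: w ↔ ∃ i, i + v.length ≤ w.length ∧ (w.drop i).take v.length = v := by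
  constructor
  · rintro ⟨s, t, rfl⟩
    exact ⟨s.length, by simp, by simp⟩
  · rintro ⟨i, -, h⟩
    rw [← h]
    exact (List.take_prefix _ _).isInfix.trans (List.drop_suffix _ _).isInfix

lemma take_drop_infix (w : List α) (i n : ℕ) : (w.drop i).take n <:+: w :=
  (List.take_prefix _ _).isInfix.trans (List.drop_suffix _ _).isInfix

lemma take_drop_window (x : ℕ → α) (p n i m : ℕ) (h : i + m ≤ n) :
    ((window x p n).drop i).take m = window x (p + i) m := by
  refine List.ext_getElem (by simp; omega) fun j h1 h2 => ?_
  simp [add_assoc]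

lemma take_drop_windowZ (x : ℤ → α) (p : ℤ) (n i m : ℕ) (h : i + m ≤ n) :
    ((windowZ x p n).drop i).take m = windowZ x (p + i) m := by
  refine List.ext_getElem (by simp; omega) fun j h1 h2 => ?_
  simp [add_assoc]

lemma windowZ_succ (x : ℤ → α) (p : ℤ) (n : ℕ) :
    windowZ x p (n + 1) = windowZ x p n ++ [x (p + n)] := by
  rw [windowZ, List.ofFn_succ_last]
  simp [windowZ]

lemma window_succ (x : ℕ → α) (p n : ℕ) :
    window x p (n + 1) = window x p n ++ [x (p + n)] := by
  rw [window, List.ofFn_succ_last]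
  simp [window]

lemma isFactorial_right (x : ℕ → α) : IsFactorial (GWord.right x).factors := by
  rintro _ ⟨p, n, rfl⟩ v hv
  obtain ⟨i, hi, h⟩ := isInfix_iff_take_drop.1 hv
  rw [take_drop_window _ _ _ _ _ (by simpa using hi)] at h
  exact ⟨_, _, h.symm⟩

lemma isFactorial_two (x : ℤ → α) : IsFactorial (GWord.two x).factors := by
  rintro _ ⟨p, n, rfl⟩ v hv
  obtain ⟨i, hi, h⟩ := isInfix_iff_take_drop.1 hv
  rw [take_drop_windowZ _ _ _ _ _ (by simpa using hi)] at h
  exact ⟨_, _, h.symm⟩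

lemma mem_left_factors_iff {x : ℕ → α} {w : List α} :
    w ∈ (GWord.left x).factors ↔ w.reverse ∈ (GWord.right x).factors := by
  simp only [GWord.factors, Set.mem_ofPred_eq, List.reverse_eq_iff]

lemma IsFactorial.reverse {L : Set (List α)} (hL : IsFactorial L) :
    IsFactorial {w | w.reverse ∈ L} :=
  fun w hw v hv => hL w.reverse hw v.reverse (by simpa using hv)

lemma isFactorial_left (x : ℕ → α) : IsFactorial (GWord.left x).factors := by
  have h := (isFactorial_right x).reverse
  convert h using 1
  ext w
  exact mem_left_factors_iff

lemma GWord.isFactorial_factors : ∀ W : GWord α, IsFactorial W.factors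
  | .fin _ => fun _ hw _ hv => hv.trans hw
  | .right x => isFactorial_right x
  | .left x => isFactorial_left x
  | .two x => isFactorial_two x

lemma growth_reverse (L : Set (List α)) (n : ℕ) : growth {w | w.reverse ∈ L} n = growth L n := by
  have : {w | w ∈ L ∧ w.length = n} =
      List.reverse '' {w | w ∈ {w | w.reverse ∈ L} ∧ w.length = n} := by
    ext w
    constructor
    · rintro ⟨h, h'⟩
      exact ⟨w.reverse, ⟨by simpa using h, by simpa using h'⟩, by simp⟩
    · rintro ⟨w, ⟨h, h'⟩, rfl⟩
      exact ⟨h, by simpa using h'⟩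
  rw [growth, growth, this, List.reverse_injective.injOn.ncard_image]

lemma right_extendable (x : ℕ → α) (w : List α) (hw : w ∈ (GWord.right x).factors) :
    ∃ a, w ++ [a] ∈ (GWord.right x).factors := by
  obtain ⟨p, n, rfl⟩ := hw
  exact ⟨_, p, n + 1, (window_succ x p n).symm⟩

lemma two_extendable (x : ℤ → α) (w : List α) (hw : w ∈ (GWord.two x).factors) :
    ∃ a, w ++ [a] ∈ (GWord.two x).factors := by
  obtain ⟨p, n, rfl⟩ := hw
  exact ⟨_, p, n + 1, (windowZ_succ x p n).symm⟩

end Windows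

/-! ### Growth -/

section Growth

variable {α : Type v} [Finite α]

lemma growth_mono {F L : Set (List α)} (h : F ⊆ L) (n : ℕ) : growth F n ≤ growth L n :=
  Set.ncard_le_ncard (fun _ hw => ⟨h hw.1, hw.2⟩) (finite_words_length_eq _ n)

lemma growth_add_ncard_diff {F L : Set (List α)} (h : F ⊆ L) (n : ℕ) :
    growth F n + {w | (w ∈ L ∧ w ∉ F) ∧ w.length = n}.ncard = growth L n := by
  rw [growth, growth, ← Set.ncard_union_eq _ (finite_words_length_eq _ n)
    (finite_words_length_eq _ n)]
  · congr 1
    ext w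
    simp only [Set.mem_union, Set.mem_ofPred_eq]
    constructor
    · rintro (⟨h1, h2⟩ | ⟨h1, h2⟩)
      exacts [⟨h h1, h2⟩, ⟨h1.1, h2⟩]
    · rintro ⟨h1, h2⟩
      by_cases hw : w ∈ F
      exacts [Or.inl ⟨hw, h2⟩, Or.inr ⟨⟨h1, hw⟩, h2⟩]
  · rw [Set.disjoint_left]
    rintro w ⟨h1, -⟩ ⟨h2, -⟩
    exact h2.2 h1

/-- If the growth of a right-extendable factorial language does not increase, then every word of
the given length has only one right extension. -/
lemma extension_unique_of_growth_le {F : Set (List α)}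
    (hext : ∀ w ∈ F, ∃ a, w ++ [a] ∈ F) {n : ℕ} (hn : growth F (n + 1) ≤ growth F n)
    {w : List α} (hw : w.length = n) {a b : α} (ha : w ++ [a] ∈ F) (hb : w ++ [b] ∈ F) :
    a = b := by
  -- Deleting the last letter maps words of length `n + 1` onto words of length `n`; the count then
  -- forces injectivity.
  have hsurj : {w | w ∈ F ∧ w.length = n} ⊆
      List.dropLast '' {w | w ∈ F ∧ w.length = n + 1} := by
    rintro v ⟨hv, hvn⟩
    obtain ⟨c, hc⟩ := hext v hv
    exact ⟨v ++ [c], ⟨hc, by simp [hvn]⟩, by simp⟩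
  have hfin := finite_words_length_eq (· ∈ F) (n + 1)
  have hcard : (List.dropLast '' {w | w ∈ F ∧ w.length = n + 1}).ncard =
      {w | w ∈ F ∧ w.length = n + 1}.ncard :=
    le_antisymm (Set.ncard_image_le hfin)
      (hn.trans (Set.ncard_le_ncard hsurj (hfin.image _)))
  have hinj := Set.injOn_of_ncard_image_eq hcard hfin
  have := hinj (x₁ := w ++ [a]) (x₂ := w ++ [b]) ⟨ha, by simp [hw]⟩ ⟨hb, by simp [hw]⟩ (by simp)
  simpa using this

lemma exists_lt_map_eq {f : ℕ → List α} {n : ℕ} (hf : ∀ i, (f i).length = n) :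
    ∃ p q, p < q ∧ q ≤ {w : List α | w.length = n}.ncard ∧ f p = f q := by
  set M := {w : List α | w.length = n}.ncard with hM
  obtain ⟨p, hp, q, hq, hne, h⟩ := Set.exists_ne_map_eq_of_ncard_lt_of_maps_to
    (s := Set.Iio (M + 1)) (t := {w : List α | w.length = n}) (f := f)
    (by rw [← Finset.coe_Iio, Set.ncard_coe_finset, ← hM]; simp) (fun i _ => hf i)
    (List.finite_length_eq α n)
  rw [Set.mem_Iio] at hp hq
  rcases lt_or_gt_of_ne hne with h' | h'
  exacts [⟨p, q, h', by omega, h⟩, ⟨q, p, h', by omega, h.symm⟩]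

/-- Morse–Hedlund: if the growth stalls at `n`, each window of length `n` determines the next
letter. A repeated window makes the sequence eventually periodic, and recurrence removes the
preperiod. -/
lemma growth_lt_succ_right {x : ℕ → α} (hr : (GWord.right x).IsRecurrent)
    (hp : ¬ (GWord.right x).IsPeriodic) (n : ℕ) :
    growth (GWord.right x).factors n < growth (GWord.right x).factors (n + 1) := by
  by_contra! hle
  apply hp
  have huniq := @extension_unique_of_growth_le α _ _ (right_extendable x) n hle
  obtain ⟨p, q, hpq, -, h⟩ := exists_lt_map_eq (f := fun p => window x p n) (n := n) (by simp)
  have key : ∀ j, window x (p + j) n = window x (q + j) n := by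
    intro j
    induction j with
    | zero => exact h
    | succ j ih =>
      have hx : x (p + j + n) = x (q + j + n) := by
        refine huniq (w := window x (p + j) n) (by simp) ⟨p + j, n + 1, (window_succ _ _ _).symm⟩ ?_
        rw [ih]
        exact ⟨q + j, n + 1, (window_succ _ _ _).symm⟩
      have h1 : window x (p + j) (n + 1) = window x (q + j) (n + 1) := by
        rw [window_succ, window_succ, ih, hx]
      rw [window_eq_window_iff] at h1 ⊢
      intro i hi
      have := h1 (i + 1) (by omega)
      rw [show p + (j + 1) + i = p + j + (i + 1) by ring, this]
      congr 1
      ring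
  have hper : ∀ i ≥ p + n, x (i + (q - p)) = x i := by
    intro i hi
    have h2 := key (i - p - n)
    have h3 : x (p + (i - p - n) + n) = x (q + (i - p - n) + n) := by
      refine huniq (w := window x (p + (i - p - n)) n) (by simp)
        ⟨_, n + 1, (window_succ _ _ _).symm⟩ ?_
      rw [h2]
      exact ⟨_, n + 1, (window_succ _ _ _).symm⟩
    rw [show p + (i - p - n) + n = i by omega,
      show q + (i - p - n) + n = i + (q - p) by omega] at h3
    exact h3.symm
  refine ⟨q - p, by omega, fun i => ?_⟩
  -- The window covering `i` and `i + (q - p)` recurs inside the periodic part.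
  obtain ⟨r, hr1, hr2⟩ := hr (window x i (q - p + 1)) ⟨_, _, rfl⟩ (p + n)
  rw [length_window, window_eq_window_iff] at hr2
  have h0 := hr2 0 (by omega)
  have h1 := hr2 (q - p) (by omega)
  rw [← h1, hper r hr1, ← add_zero i, ← h0, add_zero]

/-- Recurrence is not needed here: a repeated window can be sought arbitrarily far to the left, so
periodicity reaches every position. -/
lemma growth_lt_succ_two {x : ℤ → α} (hp : ¬ (GWord.two x).IsPeriodic) (n : ℕ) :
    growth (GWord.two x).factors n < growth (GWord.two x).factors (n + 1) := by
  by_contra! hle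
  apply hp
  have huniq := @extension_unique_of_growth_le α _ _ (two_extendable x) n hle
  have hstep : ∀ p q : ℤ, windowZ x p n = windowZ x q n → x (p + n) = x (q + n) := by
    intro p q h
    refine huniq (w := windowZ x p n) (by simp) ⟨p, n + 1, (windowZ_succ _ _ _).symm⟩ ?_
    rw [h]
    exact ⟨q, n + 1, (windowZ_succ _ _ _).symm⟩
  have key : ∀ (p q : ℤ) (_ : windowZ x p n = windowZ x q n) (j : ℕ),
      windowZ x (p + j) n = windowZ x (q + j) n := by
    intro p q h j
    induction j with
    | zero => simpa using h
    | succ j ih =>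
      have h1 : windowZ x (p + j) (n + 1) = windowZ x (q + j) (n + 1) := by
        rw [windowZ_succ, windowZ_succ, ih, hstep _ _ ih]
      rw [windowZ_eq_windowZ_iff] at h1 ⊢
      intro i hi
      have := h1 (i + 1) (by omega)
      push_cast at this ⊢
      rw [show p + (j + 1) + i = p + j + (i + 1 : ℤ) by ring, this]
      congr 1
      ring
  set M := {w : List α | w.length = n}.ncard
  -- The period found to the left of `i` depends on `i` but is at most `M`, so `M!` is a common
  -- period.
  refine ⟨M.factorial, Nat.factorial_pos _, fun i => ?_⟩
  obtain ⟨a, b, hab, hb, h⟩ := exists_lt_map_eq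
    (f := fun k : ℕ => windowZ x (i - n - M + k) n) (n := n) (by simp)
  have hper : ∀ k ≥ i, x (k + (b - a : ℕ)) = x k := by
    intro k hk
    have h2 := hstep _ _ (key _ _ h (k - n - (i - n - M + a)).toNat)
    rw [Int.toNat_of_nonneg (by omega)] at h2
    rw [show i - n - M + a + (k - n - (i - n - M + a)) + n = k by ring] at h2
    rw [h2]
    congr 1
    push_cast [hab.le]
    ring
  have hper' : ∀ m : ℕ, x (i + (b - a : ℕ) * m) = x i := by
    intro m
    induction m with
    | zero => simp
    | succ m ih =>
      rw [← ih, ← hper (i + (b - a : ℕ) * m) (le_add_of_nonneg_right (by positivity))]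
      congr 1
      push_cast
      ring
  obtain ⟨m, hm⟩ := Nat.dvd_factorial (show 0 < b - a by omega) (show b - a ≤ M by omega)
  rw [hm]
  exact_mod_cast hper' m

end Growth

/-! ### Periodic words and powers -/

section Powers

variable {α : Type v}

lemma wordPow_succ (R : List α) (k : ℕ) : wordPow R (k + 1) = R ++ wordPow R k := by
  simp [wordPow, List.replicate_succ]

lemma reverse_wordPow (R : List α) (k : ℕ) : (wordPow R.reverse k).reverse = wordPow R k := by
  simp [wordPow, List.reverse_flatten]

/-- `w = e R^k f` with `e`, `R`, `f` of length at most `B` and `R` nonempty. -/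
def IsBoundedPower (B : ℕ) (w : List α) : Prop :=
  ∃ (e R f : List α) (k : ℕ), R ≠ [] ∧ e.length ≤ B ∧ R.length ≤ B ∧ f.length ≤ B ∧
    w = e ++ wordPow R k ++ f

lemma IsBoundedPower.mono {B B' : ℕ} (h : B ≤ B') {w : List α} (hw : IsBoundedPower B w) :
    IsBoundedPower B' w := by
  obtain ⟨e, R, f, k, h1, h2, h3, h4, h5⟩ := hw
  exact ⟨e, R, f, k, h1, h2.trans h, h3.trans h, h4.trans h, h5⟩

lemma IsBoundedPower.append {B B₁ B₂ : ℕ} {w h₁ h₂ : List α} (hw : IsBoundedPower B w)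
    (h₁B : h₁.length ≤ B₁) (h₂B : h₂.length ≤ B₂) :
    IsBoundedPower (B₁ + B + B₂) (h₁ ++ w ++ h₂) := by
  obtain ⟨e, R, f, k, h1, h2, h3, h4, rfl⟩ := hw
  exact ⟨h₁ ++ e, R, f ++ h₂, k, h1, by simp; omega, by omega, by simp; omega, by simp⟩

/-- Blocks of length `d` are peeled off the front as long as the period persists; the bound on `f`
says that the remainder is short. -/
lemma eq_wordPow_append_of_period {d : ℕ} (hd : 0 < d) (l : ℕ) : ∀ z : List α,
    l + d ≤ z.length → (∀ i < l, z[i]? = z[i + d]?) →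
    ∃ (k : ℕ) (f : List α), f.length + l ≤ z.length ∧ z = wordPow (z.take d) k ++ f := by
  induction l using Nat.strong_induction_on with
  | _ l ih =>
    intro z hz hper
    rcases Nat.lt_or_ge l d with hl | hl
    · exact ⟨1, z.drop d, by simp; omega, by simp [wordPow]⟩
    · have htake : (z.drop d).take d = z.take d := by
        refine List.ext_getElem? fun i => ?_
        rcases Nat.lt_or_ge i d with hi | hi
        · simp only [List.getElem?_take, hi, if_true, List.getElem?_drop]
          rw [hper i (by omega), add_comm]
        · simp [hi.not_gt]
      obtain ⟨k, f, hf, h⟩ := ih (l - d) (by omega) (z.drop d) (by simp; omega) fun i hi => by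
        rw [List.getElem?_drop, List.getElem?_drop, add_comm d i, hper (i + d) (by omega)]
        congr 1
        omega
      refine ⟨k + 1, f, by simp at hf; omega, ?_⟩
      rw [htake] at h
      rw [wordPow_succ, List.append_assoc, ← h, List.take_append_drop]

lemma isBoundedPower_of_period {d i₀ j₀ : ℕ} (hd : 0 < d) {w : List α}
    (hlen : i₀ + d + j₀ ≤ w.length)
    (hper : ∀ i, i₀ ≤ i → i + d + j₀ < w.length → w[i]? = w[i + d]?) :
    IsBoundedPower (i₀ + d + j₀) w := by
  obtain ⟨k, f, hf, h⟩ := eq_wordPow_append_of_period hd (w.length - i₀ - d - j₀) (w.drop i₀)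
    (by simp; omega) fun i hi => by
      rw [List.getElem?_drop, List.getElem?_drop, hper _ (by omega) (by omega), add_assoc]
  refine ⟨w.take i₀, (w.drop i₀).take d, f, k, ?_, by simp; omega, by simp; omega, ?_, ?_⟩
  · rw [← List.length_pos_iff]
    simp
    omega
  · simp at hf
    omega
  · rw [List.append_assoc, ← h, List.take_append_drop]

/-- The `C + 1` windows of length `|w| - C` all contain the middle of `w`, so none lies in `F`. Two
of them coincide, which gives `w` a period at most `C` away from its ends. -/
lemma isBoundedPower_of_ncard_le [Finite α] {L F : Set (List α)} (hL : IsFactorial L)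
    (hF : IsFactorial F) {C : ℕ}
    (hC : ∀ n, {w | (w ∈ L ∧ w ∉ F) ∧ w.length = n}.ncard ≤ C) {w : List α} (hw : w ∈ L)
    (hlen : 3 * C ≤ w.length) (hmid : (w.drop C).take (w.length - 2 * C) ∉ F) :
    IsBoundedPower (3 * C) w := by
  set N := w.length with hN
  have hmaps : ∀ i ∈ Set.Iio (C + 1), (w.drop i).take (N - C) ∈
      {v | (v ∈ L ∧ v ∉ F) ∧ v.length = N - C} := by
    intro i hi
    rw [Set.mem_Iio] at hi
    refine ⟨⟨hL _ hw _ (take_drop_infix _ _ _), fun h => hmid (hF _ h _ ?_)⟩, by simp; omega⟩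
    rw [isInfix_iff_take_drop]
    refine ⟨C - i, by simp; omega, ?_⟩
    rw [List.drop_take, List.drop_drop, List.take_take]
    simp only [List.length_take, List.length_drop]
    rw [show i + (C - i) = C by omega]
    congr 1
    omega
  obtain ⟨p, hp, q, hq, hne, h⟩ := Set.exists_ne_map_eq_of_ncard_lt_of_maps_to
    (by rw [← Finset.coe_Iio, Set.ncard_coe_finset]; simpa [Nat.lt_succ_iff] using hC (N - C))
    hmaps (finite_words_length_eq _ _)
  wlog hpq : p < q generalizing p q
  · exact this q hq p hp hne.symm h.symm (lt_of_le_of_ne (not_lt.1 hpq) hne.symm)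
  rw [Set.mem_Iio] at hp hq
  refine (isBoundedPower_of_period (d := q - p) (i₀ := C) (j₀ := C) (by omega) (by omega)
    fun i hi hi' => ?_).mono (by omega)
  have := congrArg (fun l => l[i - p]?) h
  simp only [List.getElem?_take, List.getElem?_drop] at this
  rw [if_pos (by omega), if_pos (by omega)] at this
  rw [show p + (i - p) = i by omega, show q + (i - p) = i + (q - p) by omega] at this
  exact this

end Powers

/-! ### Families of finite words -/

section Families

variable {α : Type v}

lemma eq_factorsOf {L : Set (List α)} {S : Set (GWord α)} (h₁ : ∀ X ∈ S, X.factors ⊆ L)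
    (h₂ : ∀ w ∈ L, ∃ X ∈ S, w ∈ X.factors) : L = factorsOf S := by
  ext w
  exact ⟨h₂ w, fun ⟨X, hX, hw⟩ => h₁ X hX hw⟩

lemma IsFactorial.fin_factors_subset {L : Set (List α)} (hL : IsFactorial L) {w : List α}
    (hw : w ∈ L) : (GWord.fin w).factors ⊆ L :=
  fun v hv => hL w hw v hv

lemma mem_fin_factors (w : List α) : w ∈ (GWord.fin w).factors := List.infix_rfl

lemma isLeftPeriodicFamily_empty : IsLeftPeriodicFamily (∅ : Set (GWord α)) :=
  ⟨0, fun i => i.elim0, fun i => i.elim0, fun i => i.elim0, by simp⟩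

lemma isRightPeriodicFamily_empty : IsRightPeriodicFamily (∅ : Set (GWord α)) :=
  ⟨0, fun i => i.elim0, fun i => i.elim0, fun i => i.elim0, by simp⟩

lemma isRightTailFamily_empty (W : GWord α) : IsRightTailFamily W ∅ :=
  ⟨0, fun i => i.elim0, fun i => i.elim0, fun i => i.elim0, fun i => i.elim0, by simp⟩

lemma isLeftTailFamily_empty (W : GWord α) : IsLeftTailFamily W ∅ :=
  ⟨0, fun i => i.elim0, fun i => i.elim0, fun i => i.elim0, fun i => i.elim0, by simp⟩

variable [Finite α]

lemma isFiniteFamily_short (L : Set (List α)) (B : ℕ) :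
    IsFiniteFamily (GWord.fin '' {w | w ∈ L ∧ w.length ≤ B}) :=
  ⟨_, finite_words_length_le _ B, rfl⟩

/-- There are finitely many triples `(e, R, f)` of bounded length; each gives one series, with all
exponents that keep the word in `L`. -/
lemma isPowerFamily_boundedPower (L : Set (List α)) (B : ℕ) :
    IsPowerFamily (GWord.fin '' {w | w ∈ L ∧ IsBoundedPower B w}) := by
  let T : Set (List α × List α × List α) :=
    {q | q.2.1 ≠ [] ∧ q.1.length ≤ B ∧ q.2.1.length ≤ B ∧ q.2.2.length ≤ B}
  have hB := List.finite_length_le α B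
  have hT : T.Finite := (hB.prod (hB.prod hB)).subset fun q hq => ⟨hq.2.1, hq.2.2.1, hq.2.2.2⟩
  obtain ⟨r, g, hg⟩ := hT.fin_embedding
  have hgT : ∀ i, g i ∈ T := fun i => hg ▸ Set.mem_range_self i
  refine ⟨r, fun i => (g i).1, fun i => (g i).2.1, fun i => (g i).2.2,
    fun i => {k | (g i).1 ++ wordPow (g i).2.1 k ++ (g i).2.2 ∈ L}, fun i => (hgT i).1, ?_⟩
  ext X
  constructor
  · rintro ⟨w, ⟨hw, e, R, f, k, h1, h2, h3, h4, rfl⟩, rfl⟩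
    obtain ⟨i, hi⟩ : (e, R, f) ∈ Set.range g := hg ▸ ⟨h1, h2, h3, h4⟩
    exact ⟨i, k, by simpa [hi] using hw, by simp [hi]⟩
  · rintro ⟨i, k, hk, rfl⟩
    obtain ⟨h1, h2, h3, h4⟩ := hgT i
    exact ⟨_, ⟨hk, _, _, _, _, h1, h2, h3, h4, rfl⟩, rfl⟩

theorem descriptionSlow {L : Set (List α)} (hL : IsFactorial L) (hb : HasBoundedGrowth L) :
    DescriptionSlow L := by
  obtain ⟨C, hC⟩ := hb
  refine ⟨_, ∅, ∅, _, isFiniteFamily_short L (3 * C), isLeftPeriodicFamily_empty,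
    isRightPeriodicFamily_empty, isPowerFamily_boundedPower L (3 * C), ?_⟩
  refine eq_factorsOf ?_ fun w hw => ⟨.fin w, ?_, mem_fin_factors w⟩
  · rintro X (((⟨w, hw, rfl⟩ | hX) | hX) | ⟨w, hw, rfl⟩)
    exacts [hL.fin_factors_subset hw.1, hX.elim, hX.elim, hL.fin_factors_subset hw.1]
  · rcases le_total w.length (3 * C) with h | h
    · exact Or.inl (Or.inl (Or.inl ⟨w, ⟨hw, h⟩, rfl⟩))
    · refine Or.inr ⟨w, ⟨hw, isBoundedPower_of_ncard_le hL (F := ∅) (fun _ h => h.elim)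
        (fun n => ?_) hw h (Set.notMem_empty _)⟩, rfl⟩
      simpa [growth] using hC n

end Families

/-! ### Obstructions -/

section Obstructions

variable {α : Type v} {F : Set (List α)}

/-- A shortest factor outside `F` is an obstruction. -/
lemma exists_obstruction {t : List α} (ht : t ∉ F) :
    ∃ q, q ∈ obstructionOccurrences F t := by
  classical
  have hex : ∃ n, ∃ v : List α, v.length = n ∧ v <:+: t ∧ v ∉ F := ⟨_, t, rfl, List.infix_rfl, ht⟩
  obtain ⟨v, hv, hvt, hvF⟩ := Nat.find_spec hex
  obtain ⟨i, hi, h⟩ := isInfix_iff_take_drop.1 hvt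
  refine ⟨(i, v.length), hi, ?_⟩
  simp only [h]
  refine ⟨hvF, fun v' hv' hne => ?_⟩
  by_contra hF'
  have hlt : v'.length < Nat.find hex := by
    rw [← hv]
    exact lt_of_le_of_ne hv'.length_le fun h => hne (hv'.eq_of_length h)
  exact Nat.find_min hex hlt ⟨v', rfl, hv'.trans hvt, hF'⟩

lemma obstructionOccurrences_antichain {t : List α} {p q : ℕ × ℕ}
    (hp : p ∈ obstructionOccurrences F t) (hq : q ∈ obstructionOccurrences F t)
    (h₁ : q.1 ≤ p.1) (h₂ : p.1 + p.2 ≤ q.1 + q.2) : p = q := by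
  obtain ⟨hpt, hpo⟩ := hp
  obtain ⟨hqt, hqo⟩ := hq
  have hinf : (t.drop p.1).take p.2 <:+: (t.drop q.1).take q.2 := by
    rw [isInfix_iff_take_drop]
    refine ⟨p.1 - q.1, by simp; omega, ?_⟩
    rw [List.drop_take, List.drop_drop, List.take_take]
    simp only [List.length_take, List.length_drop]
    rw [show q.1 + (p.1 - q.1) = p.1 by omega]
    congr 1
    omega
  by_contra hne
  refine hpo.1 (hqo.2 _ hinf fun h => hne ?_)
  have := congrArg List.length h
  simp only [List.length_take, List.length_drop] at this
  ext <;> omega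

/-- Since deleting one end letter lands in `F`, every occurrence must touch that end. Such
occurrences are nested, and nested occurrences coincide. -/
lemma ncard_obstructionOccurrences_eq_one (hF : IsFactorial F) {t : List α} (ht : t ∉ F)
    (h : t.tail ∈ F ∨ t.dropLast ∈ F) : (obstructionOccurrences F t).ncard = 1 := by
  obtain ⟨q, hq⟩ := exists_obstruction ht
  have key : (∀ p ∈ obstructionOccurrences F t, p.1 = 0) ∨
      ∀ p ∈ obstructionOccurrences F t, p.1 + p.2 = t.length := by
    refine h.imp (fun h p hp => ?_) fun h p hp => ?_
    · by_contra h0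
      refine hp.2.1 (hF _ h _ ?_)
      rw [show p.1 = 1 + (p.1 - 1) by omega, ← List.drop_drop, List.drop_one]
      exact take_drop_infix _ _ _
    · by_contra h0
      refine hp.2.1 (hF _ h _ ?_)
      have := hp.1
      rw [isInfix_iff_take_drop]
      refine ⟨p.1, by simp; omega, ?_⟩
      rw [List.dropLast_eq_take, List.drop_take, List.take_take]
      simp only [List.length_take, List.length_drop]
      congr 1
      omega
  rw [Set.ncard_eq_one]
  refine ⟨q, Set.eq_singleton_iff_unique_mem.2 ⟨hq, fun p hp => ?_⟩⟩
  rcases key with key | key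
  · have h1 := key p hp
    have h2 := key q hq
    rcases le_total p.2 q.2 with h3 | h3
    · exact obstructionOccurrences_antichain hp hq (by omega) (by omega)
    · exact (obstructionOccurrences_antichain hq hp (by omega) (by omega)).symm
  · have h1 := key p hp
    have h2 := key q hq
    rcases le_total p.1 q.1 with h3 | h3
    · exact (obstructionOccurrences_antichain hq hp (by omega) (by omega)).symm
    · exact obstructionOccurrences_antichain hp hq (by omega) (by omega)

/-- Letters of `h` are appended one at a time until the word first leaves `F`. -/
lemma exists_prefix_dropLast_mem {t : List α} (ht : t ∈ F) {h : List α} (hth : t ++ h ∉ F) :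
    ∃ t' h', t ++ h = t' ++ h' ∧ h'.length ≤ h.length ∧ t' ∉ F ∧ t'.dropLast ∈ F := by
  induction h generalizing t with
  | nil => simp [ht] at hth
  | cons x h ih =>
    by_cases hx : t ++ [x] ∈ F
    · obtain ⟨t', h', h1, h2, h3⟩ := ih hx (by simpa using hth)
      exact ⟨t', h', by simpa using h1, by simp; omega, h3⟩
    · exact ⟨t ++ [x], h, by simp, by simp, hx, by simpa using ht⟩

lemma exists_suffix_tail_mem {t : List α} (ht : t ∈ F) {h : List α} (hth : h ++ t ∉ F) :
    ∃ h' t', h ++ t = h' ++ t' ∧ h'.length ≤ h.length ∧ t' ∉ F ∧ t'.tail ∈ F := by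
  induction h using List.reverseRecOn generalizing t with
  | nil => simp [ht] at hth
  | append_singleton h x ih =>
    by_cases hx : x :: t ∈ F
    · obtain ⟨h', t', h1, h2, h3⟩ := ih hx (by simpa using hth)
      exact ⟨h', t', by simpa using h1, by simp; omega, h3⟩
    · exact ⟨h, x :: t, by simp, by simp, hx, by simpa using ht⟩

lemma exists_one_obstruction (hF : IsFactorial F) {h₁ t h₂ : List α} (ht : t ∈ F)
    (h : h₁ ++ t ++ h₂ ∉ F) :
    ∃ h₁' t' h₂', h₁ ++ t ++ h₂ = h₁' ++ t' ++ h₂' ∧ h₁'.length ≤ h₁.length ∧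
      h₂'.length ≤ h₂.length ∧ (obstructionOccurrences F t').ncard = 1 := by
  by_cases h' : h₁ ++ t ∈ F
  · obtain ⟨t', h₂', e1, e2, e3, e4⟩ := exists_prefix_dropLast_mem h' h
    exact ⟨[], t', h₂', by simpa using e1, by simp, e2,
      ncard_obstructionOccurrences_eq_one hF e3 (Or.inr e4)⟩
  · obtain ⟨h₁', t', e1, e2, e3, e4⟩ := exists_suffix_tail_mem ht h'
    exact ⟨h₁', t', h₂, by rw [e1], e2, le_rfl,
      ncard_obstructionOccurrences_eq_one hF e3 (Or.inl e4)⟩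

end Obstructions

/-! ### The description in the presence of a nonperiodic superword -/

section RelativeGrowth

variable {α : Type v} [Finite α]

lemma growth_lt_succ : ∀ {W : GWord α}, W.IsRecurrent → ¬ W.IsPeriodic → ∀ n,
    growth W.factors n < growth W.factors (n + 1)
  | .fin _, hr, _, _ => hr.elim
  | .right _, hr, hp, n => growth_lt_succ_right hr hp n
  | .two _, _, hp, n => growth_lt_succ_two hp n
  | .left x, hr, hp, n => by
    have hF : (GWord.left x).factors = {w | w.reverse ∈ (GWord.right x).factors} :=
      Set.ext fun w => mem_left_factors_iff
    rw [hF, growth_reverse, growth_reverse]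
    refine growth_lt_succ_right (fun v hv N => ?_) hp n
    obtain ⟨p, hp, h⟩ := hr v.reverse (mem_left_factors_iff.2 (by simpa using hv)) N
    exact ⟨p, hp, by simpa using h⟩

lemma le_of_lt_succ {g : ℕ → ℕ} (hg : ∀ n, g n < g (n + 1)) (n : ℕ) : n ≤ g n :=
  (strictMono_nat_of_lt_succ hg).le_apply

/-- The difference `g n - n` is nondecreasing and bounded. -/
lemma eventually_eq_add_of_lt_succ {g : ℕ → ℕ} (hg : ∀ n, g n < g (n + 1)) {C : ℕ}
    (hC : ∀ n, g n ≤ n + C) : ∃ K N : ℕ, ∀ n ≥ N, g n = n + K := by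
  by_contra! hne
  have hmono : ∀ m k, g m + k ≤ g (m + k) := by
    intro m k
    induction k with
    | zero => rfl
    | succ k ih =>
      have := hg (m + k)
      rw [← add_assoc m k 1]
      omega
  have hunb : ∀ k, ∃ n, n + k ≤ g n := by
    intro k
    induction k with
    | zero => exact ⟨0, by omega⟩
    | succ k ih =>
      obtain ⟨N, hN⟩ := ih
      obtain ⟨n, hn, h⟩ := hne (g N - N) N
      have := hmono N (n - N)
      rw [show N + (n - N) = n by omega] at this
      exact ⟨n, by omega⟩
  obtain ⟨n, hn⟩ := hunb (C + 1)
  have := hC n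
  omega

lemma ncard_diff_le {F L : Set (List α)} (hFL : F ⊆ L) (hF : ∀ n, n ≤ growth F n) {C : ℕ}
    (hC : ∀ n, growth L n ≤ n + C) (n : ℕ) :
    {w | (w ∈ L ∧ w ∉ F) ∧ w.length = n}.ncard ≤ C := by
  have h1 := growth_add_ncard_diff hFL n
  have h2 := hF n
  have h3 := hC n
  omega

/-- One series for each of the finitely many pairs of short end words. Condition (c) is the bound on
the part of `L` outside `W.factors`. -/
lemma isTwoObstructionFamily_one (W : GWord α) {L : Set (List α)} (hL : IsFactorial L) {C : ℕ}
    (hC : ∀ n, {w | (w ∈ L ∧ w ∉ W.factors) ∧ w.length = n}.ncard ≤ C) (B : ℕ) :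
    IsTwoObstructionFamily W (GWord.fin '' {w | w ∈ L ∧ ∃ h₁ t h₂ : List α,
      w = h₁ ++ t ++ h₂ ∧ h₁.length ≤ B ∧ h₂.length ≤ B ∧
        (obstructionOccurrences W.factors t).ncard = 1}) := by
  let T : Set (List α × List α) := {q | q.1.length ≤ B ∧ q.2.length ≤ B}
  have hB := List.finite_length_le α B
  have hT : T.Finite := (hB.prod hB).subset fun q hq => ⟨hq.1, hq.2⟩
  obtain ⟨r, g, hg⟩ := hT.fin_embedding
  have hgT : ∀ i, g i ∈ T := fun i => hg ▸ Set.mem_range_self i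
  refine ⟨r, fun i => (g i).1, fun i => (g i).2,
    fun i => {t | (g i).1 ++ t ++ (g i).2 ∈ L ∧
      (obstructionOccurrences W.factors t).ncard = 1}, ?_, ?_, ⟨2 * B + 1, fun i => ?_⟩,
    C + 1, by omega, fun k => ?_⟩
  · ext X
    constructor
    · rintro ⟨w, ⟨hw, h₁, t, h₂, rfl, h1, h2, h3⟩, rfl⟩
      obtain ⟨i, hi⟩ : (h₁, h₂) ∈ Set.range g := hg ▸ ⟨h1, h2⟩
      exact ⟨i, t, by simpa [hi] using And.intro hw h3, by simp [hi]⟩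
    · rintro ⟨i, t, ht, rfl⟩
      exact ⟨_, ⟨ht.1, _, t, _, rfl, (hgT i).1, (hgT i).2, ht.2⟩, rfl⟩
  · rintro i t ⟨-, ht⟩
    rw [ht]
    omega
  · have h1 : (g i).1.length ≤ B := (hgT i).1
    have h2 : (g i).2.length ≤ B := (hgT i).2
    dsimp only
    omega
  · refine (Set.ncard_le_ncard ?_ (finite_words_length_eq _ k)).trans ((hC k).trans (by omega))
    rintro w ⟨⟨_, ⟨w', hw', rfl⟩, hw⟩, hwF, hk⟩
    exact ⟨⟨hL _ hw'.1 _ hw, hwF⟩, hk⟩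

theorem descriptionTwo {L : Set (List α)} (hL : IsFactorial L) (hT : IsBoundary L) {W : GWord α}
    (hW : IsURNonperiodicIn W L) : DescriptionTwo W L := by
  obtain ⟨C, hC⟩ := hT
  obtain ⟨⟨hr, -⟩, hp, hWL⟩ := hW
  have hlt := growth_lt_succ hr hp
  have hF := W.isFactorial_factors
  have hdiff := ncard_diff_le hWL (le_of_lt_succ hlt) hC
  refine ⟨eventually_eq_add_of_lt_succ hlt fun n => (growth_mono hWL n).trans (hC n),
    _, ∅, ∅, _, ∅, ∅, _, isFiniteFamily_short L (3 * C), isLeftPeriodicFamily_empty,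
    isRightPeriodicFamily_empty, isPowerFamily_boundedPower L (3 * C), isRightTailFamily_empty W,
    isLeftTailFamily_empty W, isTwoObstructionFamily_one W hL hdiff C, eq_factorsOf ?_ ?_⟩
  · rintro X (((((((hX | ⟨w, hw, rfl⟩) | hX) | hX) | ⟨w, hw, rfl⟩) | hX) | hX) | ⟨w, hw, rfl⟩)
    · rw [Set.mem_singleton_iff.1 hX]
      exact hWL
    exacts [hL.fin_factors_subset hw.1, hX.elim, hX.elim, hL.fin_factors_subset hw.1, hX.elim,
      hX.elim, hL.fin_factors_subset hw.1]
  · intro w hw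
    by_cases hwF : w ∈ W.factors
    · exact ⟨W, by simp, hwF⟩
    refine ⟨.fin w, ?_, mem_fin_factors w⟩
    rcases le_total w.length (3 * C) with h | h
    · have : GWord.fin w ∈ GWord.fin '' {w | w ∈ L ∧ w.length ≤ 3 * C} := ⟨w, ⟨hw, h⟩, rfl⟩
      simp only [Set.mem_union, this, true_or, or_true]
    by_cases hmid : (w.drop C).take (w.length - 2 * C) ∈ W.factors
    · have hsplit : w = w.take C ++ (w.drop C).take (w.length - 2 * C) ++
          w.drop (w.length - C) := by
        rw [show w.length - C = C + (w.length - 2 * C) by omega, ← List.drop_drop,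
          List.append_assoc, List.take_append_drop, List.take_append_drop]
      obtain ⟨h₁, t, h₂, e1, e2, e3, e4⟩ := exists_one_obstruction hF hmid (hsplit ▸ hwF)
      rw [← hsplit] at e1
      refine Or.inr ⟨w, ⟨hw, h₁, t, h₂, e1, e2.trans (by simp), e3.trans (by simp; omega), e4⟩, rfl⟩
    · have : GWord.fin w ∈ GWord.fin '' {w | w ∈ L ∧ IsBoundedPower (3 * C) w} :=
        ⟨w, ⟨hw, isBoundedPower_of_ncard_le hL hF hdiff hw h hmid⟩, rfl⟩
      simp only [Set.mem_union, this, true_or, or_true]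

end RelativeGrowth

/-! ### Words with two periodic tails -/

section TwoTails

variable {α : Type v}

lemma repeatWord_add_length (u : List α) (hu : u ≠ []) (i : ℕ) :
    repeatWord u hu (i + u.length) = repeatWord u hu i := by
  simp [repeatWord]

lemma exists_window_repeatWord_eq (u : List α) (hu : u ≠ []) (n : ℕ) :
    ∃ (k : ℕ) (g : List α), g.length ≤ u.length ∧
      window (repeatWord u hu) 0 n = wordPow u k ++ g := by
  induction n using Nat.strong_induction_on with
  | _ n ih =>
    have hpos := List.length_pos_iff.2 hu
    rcases Nat.lt_or_ge n u.length with hn | hn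
    · exact ⟨0, window (repeatWord u hu) 0 n, by simp; omega, by simp [wordPow]⟩
    · obtain ⟨k, g, hg, h⟩ := ih (n - u.length) (by omega)
      refine ⟨k + 1, g, hg, ?_⟩
      rw [wordPow_succ, List.append_assoc, ← h]
      refine List.ext_getElem (by simp; omega) fun i h1 h2 => ?_
      rcases Nat.lt_or_ge i u.length with hi | hi
      · simp [List.getElem_append_left hi, repeatWord, Nat.mod_eq_of_lt hi]
      · rw [List.getElem_append_right hi]
        simp only [getElem_window, zero_add]
        rw [← repeatWord_add_length u hu (i - u.length), Nat.sub_add_cancel hi]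

lemma windowZ_add (x : ℤ → α) (p : ℤ) (m n : ℕ) :
    windowZ x p (m + n) = windowZ x p m ++ windowZ x (p + m) n := by
  refine List.ext_getElem (by simp) fun i h1 h2 => ?_
  rcases Nat.lt_or_ge i m with hi | hi
  · rw [List.getElem_append_left (by simpa using hi)]
    simp
  · rw [List.getElem_append_right (by simpa using hi)]
    simp only [getElem_windowZ, length_windowZ]
    congr 1
    omega

@[simp] lemma glue_natCast (l r : ℕ → α) (n : ℕ) : glue l r n = r n := rfl

lemma glue_neg (l r : ℕ → α) (n : ℕ) : glue l r (-(n + 1 : ℤ)) = l n := by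
  rw [← Int.negSucc_eq]
  rfl

variable {u c v : List α} {hu : u ≠ []} {hv : v ≠ []}

lemma twoTails_left_period {i : ℤ} (hi : i + u.length < 0) :
    twoTails u c v hu hv (i + u.length) = twoTails u c v hu hv i := by
  obtain ⟨m, hm⟩ : ∃ m : ℕ, i + u.length = -(m + 1 : ℤ) :=
    ⟨(-(i + u.length) - 1).toNat, by omega⟩
  have h2 : i = -((m + u.length : ℕ) + 1 : ℤ) := by push_cast; omega
  rw [hm, twoTails, glue_neg, h2, glue_neg, repeatLeft]
  have := repeatWord_add_length u.reverse (by simpa using hu) m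
  rw [List.length_reverse] at this
  exact this.symm

lemma twoTails_right_period {i : ℤ} (hi : c.length ≤ i) :
    twoTails u c v hu hv (i + v.length) = twoTails u c v hu hv i := by
  obtain ⟨m, rfl⟩ : ∃ m : ℕ, i = (c.length + m : ℕ) := ⟨(i - c.length).toNat, by omega⟩
  rw [← Nat.cast_add, twoTails, glue_natCast, glue_natCast, prepend, prepend, dif_neg (by omega),
    dif_neg (by omega), show c.length + m + v.length - c.length = m + v.length by omega,
    repeatWord_add_length]
  congr 1
  omega

lemma windowZ_twoTails (a b : ℕ) :
    windowZ (twoTails u c v hu hv) (-a) (a + c.length + b) =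
      (window (repeatLeft u hu) 0 a).reverse ++ c ++ window (repeatWord v hv) 0 b := by
  rw [windowZ_add, windowZ_add]
  congr 1
  · congr 1
    · refine List.ext_getElem (by simp) fun i h1 h2 => ?_
      simp only [length_windowZ] at h1
      rw [getElem_windowZ, List.getElem_reverse, getElem_window, length_window,
        show (-a + i : ℤ) = -((a - 1 - i : ℕ) + 1 : ℤ) by omega, twoTails, glue_neg, zero_add]
    · refine List.ext_getElem (by simp) fun i h1 h2 => ?_
      rw [getElem_windowZ, neg_add_cancel, zero_add, twoTails, glue_natCast, prepend, dif_pos h2]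
  · refine List.ext_getElem (by simp) fun i h1 h2 => ?_
    rw [getElem_windowZ, getElem_window, show (-a + (a + c.length : ℕ) + i : ℤ) =
      (c.length + i : ℕ) by push_cast; ring, twoTails, glue_natCast, prepend, dif_neg (by omega)]
    congr 1
    omega

/-- Away from the origin this is the periodicity of the two tails; only a step from negative to
nonnegative positions needs a direct computation. -/
lemma twoPeriodic_periodic (u : List α) (hu : u ≠ []) :
    Function.Periodic (twoPeriodic u hu) (u.length : ℤ) := by
  intro i
  have hpos := List.length_pos_iff.2 hu
  have hnil : twoPeriodic u hu = twoTails u [] u hu hu := by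
    rw [twoPeriodic, twoTails]
    congr 1
  rcases lt_or_ge (i + u.length) 0 with h | h
  · rw [hnil, twoTails_left_period h]
  rcases lt_or_ge i 0 with h' | h'
  · obtain ⟨m, hm⟩ : ∃ m : ℕ, i = -(m + 1 : ℤ) := ⟨(-i - 1).toNat, by omega⟩
    obtain ⟨k, hk⟩ : ∃ k : ℕ, i + u.length = k := ⟨(i + u.length).toNat, by omega⟩
    rw [hk, hm, twoPeriodic, glue_natCast, glue_neg]
    simp only [repeatLeft, repeatWord, List.getElem_reverse, List.length_reverse]
    congr 1
    rw [Nat.mod_eq_of_lt (by omega), Nat.mod_eq_of_lt (by omega)]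
    omega
  · rw [hnil, twoTails_right_period (by simpa using h')]

/-- If the word had period `d`, it and `u^∞` would share the period `|u| d`; they agree on the
negative half-line, hence everywhere. -/
lemma twoTails_not_isPeriodic (h : twoTails u c v hu hv ≠ twoPeriodic u hu) :
    ¬ (GWord.two (twoTails u c v hu hv)).IsPeriodic := by
  rintro ⟨d, hd, hper⟩
  apply h
  have hX : Function.Periodic (twoTails u c v hu hv) (u.length * d) :=
    Function.Periodic.nat_mul hper u.length
  have hY : Function.Periodic (twoPeriodic u hu) (u.length * d) := by
    rw [mul_comm]
    exact (twoPeriodic_periodic u hu).nat_mul d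
  ext i
  have hpos : (0 : ℤ) < u.length * d := by
    have := List.length_pos_iff.2 hu
    positivity
  obtain ⟨m, hm⟩ : ∃ m : ℕ, i - (i.toNat + 1 : ℤ) * (u.length * d) = -(m + 1 : ℤ) := by
    refine ⟨(-(i - (i.toNat + 1 : ℤ) * (u.length * d)) - 1).toNat, ?_⟩
    have : (i.toNat + 1 : ℤ) * 1 ≤ (i.toNat + 1 : ℤ) * (u.length * d) := by
      gcongr
      omega
    omega
  have h1 := (hX.int_mul (i.toNat + 1)).sub_eq i
  have h2 := (hY.int_mul (i.toNat + 1)).sub_eq i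
  push_cast at h1 h2
  rw [← h1, ← h2, hm, twoTails, twoPeriodic, glue_neg, glue_neg]

/-- A factor of `… u u u c v v v …` either contains `c` and splits accordingly, or is a power up
to bounded ends. -/
lemma factor_twoTails {w : List α} (hw : w ∈ (GWord.two (twoTails u c v hu hv)).factors)
    (hlen : u.length + c.length + v.length ≤ w.length) :
    IsBoundedPower (u.length + c.length + v.length) w ∨
    ∃ (E F : List α) (n m : ℕ), E.length ≤ u.length ∧ F.length ≤ v.length ∧
      w = E ++ wordPow u n ++ c ++ wordPow v m ++ F := by
  obtain ⟨p, n, rfl⟩ := hw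
  rw [length_windowZ] at hlen
  have hu' := List.length_pos_iff.2 hu
  have hv' := List.length_pos_iff.2 hv
  -- A window starting to the right of 0 is `v`-periodic after at most `|c|` letters; one ending
  -- before the end of `c` is `u`-periodic except for at most `|c|` final letters. Otherwise it
  -- contains all of `c`.
  by_cases h1 : 0 < p
  · left
    refine (isBoundedPower_of_period (d := v.length) (i₀ := c.length) (j₀ := 0) hv'
      (by simp; omega) fun i hi hi' => ?_).mono (by omega)
    rw [length_windowZ] at hi'
    rw [List.getElem?_eq_getElem (by simp; omega), List.getElem?_eq_getElem (by simp; omega),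
      getElem_windowZ, getElem_windowZ, Nat.cast_add, ← add_assoc,
      twoTails_right_period (by omega)]
  by_cases h2 : p + n < c.length
  · left
    refine (isBoundedPower_of_period (d := u.length) (i₀ := 0) (j₀ := c.length) hu'
      (by simp; omega) fun i hi hi' => ?_).mono (by omega)
    rw [length_windowZ] at hi'
    rw [List.getElem?_eq_getElem (by simp; omega), List.getElem?_eq_getElem (by simp; omega),
      getElem_windowZ, getElem_windowZ, Nat.cast_add, ← add_assoc,
      twoTails_left_period (by omega)]
  right
  obtain ⟨a, rfl⟩ : ∃ a : ℕ, p = -a := ⟨(-p).toNat, by omega⟩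
  obtain ⟨b, rfl⟩ : ∃ b : ℕ, n = a + c.length + b := ⟨n - a - c.length, by omega⟩
  rw [windowZ_twoTails]
  obtain ⟨k, F, hF, e2⟩ := exists_window_repeatWord_eq v hv b
  obtain ⟨l, E, hE, e1⟩ := exists_window_repeatWord_eq u.reverse (by simpa using hu) a
  refine ⟨E.reverse, F, l, k, by simpa using hE, hF, ?_⟩
  rw [e2, repeatLeft, e1, List.reverse_append, reverse_wordPow]
  simp

variable [Finite α]

theorem descriptionOne_of_twoTails {L : Set (List α)} (hL : IsFactorial L) (hT : IsBoundary L)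
    (hne : twoTails u c v hu hv ≠ twoPeriodic u hu)
    (hsub : (GWord.two (twoTails u c v hu hv)).factors ⊆ L) : DescriptionOne L := by
  obtain ⟨C, hC⟩ := hT
  set W := GWord.two (twoTails u c v hu hv) with hW
  have hF := W.isFactorial_factors
  have hdiff := ncard_diff_le hsub
    (le_of_lt_succ (growth_lt_succ_two (twoTails_not_isPeriodic hne))) hC
  set B := u.length + c.length + v.length + 3 * C with hB
  let P : Set (List α × ℕ × ℕ × List α) := {q | q.1.length ≤ B ∧ q.2.2.2.length ≤ B ∧
    q.1 ++ wordPow u q.2.1 ++ c ++ wordPow v q.2.2.1 ++ q.2.2.2 ∈ L ∧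
    q.1 ++ wordPow u q.2.1 ++ c ++ wordPow v q.2.2.1 ++ q.2.2.2 ∉ W.factors}
  refine ⟨u, c, v, hu, hv, _, ∅, ∅, _, (fun q => GWord.fin (q.1 ++ wordPow u q.2.1 ++ c ++
    wordPow v q.2.2.1 ++ q.2.2.2)) '' P, hne, isFiniteFamily_short L B, isLeftPeriodicFamily_empty,
    isRightPeriodicFamily_empty, isPowerFamily_boundedPower L B,
    ⟨P, rfl, ⟨2 * B + 1, fun q hq => ?_⟩, C + 1, fun k => ?_⟩, eq_factorsOf ?_ ?_⟩
  · have h1 := hq.1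
    have h2 := hq.2.1
    omega
  · refine Nat.lt_succ_of_le ((Set.ncard_le_ncard ?_ (finite_words_length_eq _ k)).trans (hdiff k))
    rintro w ⟨⟨q, hq, hqw⟩, hk⟩
    rw [← GWord.fin.inj hqw] at hk ⊢
    exact ⟨⟨hq.2.2.1, hq.2.2.2⟩, hk⟩
  · rintro X (((((hX | ⟨w, hw, rfl⟩) | hX) | hX) | ⟨w, hw, rfl⟩) | ⟨q, hq, rfl⟩)
    · rw [Set.mem_singleton_iff.1 hX]
      exact hsub
    exacts [hL.fin_factors_subset hw.1, hX.elim, hX.elim, hL.fin_factors_subset hw.1,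
      hL.fin_factors_subset hq.2.2.1]
  · intro w hw
    by_cases hwF : w ∈ W.factors
    · exact ⟨W, by simp [hW], hwF⟩
    refine ⟨.fin w, ?_, mem_fin_factors w⟩
    rcases le_total w.length B with h | h
    · have : GWord.fin w ∈ GWord.fin '' {w | w ∈ L ∧ w.length ≤ B} := ⟨w, ⟨hw, h⟩, rfl⟩
      simp only [Set.mem_union, this, true_or, or_true]
    by_cases hpow : IsBoundedPower B w
    · have : GWord.fin w ∈ GWord.fin '' {w | w ∈ L ∧ IsBoundedPower B w} := ⟨w, ⟨hw, hpow⟩, rfl⟩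
      simp only [Set.mem_union, this, true_or, or_true]
    have hmid : (w.drop C).take (w.length - 2 * C) ∈ W.factors := by
      by_contra hmid
      exact hpow ((isBoundedPower_of_ncard_le hL hF hdiff hw (by omega) hmid).mono (by omega))
    have hsplit : w = w.take C ++ (w.drop C).take (w.length - 2 * C) ++
        w.drop (w.length - C) := by
      rw [show w.length - C = C + (w.length - 2 * C) by omega, ← List.drop_drop,
        List.append_assoc, List.take_append_drop, List.take_append_drop]
    rcases factor_twoTails hmid (by simp; omega) with hp | ⟨E, F, n, m, hE, hF, e⟩
    · refine absurd ((hp.append (h₁ := w.take C) (h₂ := w.drop (w.length - C)) (B₁ := C) (B₂ := C)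
        (by simp) (by simp; omega)).mono (B' := B) (by omega)) ?_
      rwa [← hsplit]
    · rw [e] at hsplit
      have hsplit' : w = (w.take C ++ E) ++ wordPow u n ++ c ++ wordPow v m ++
          (F ++ w.drop (w.length - C)) := hsplit.trans (by simp)
      refine Or.inr ⟨(w.take C ++ E, n, m, F ++ w.drop (w.length - C)), ⟨?_, ?_, ?_, ?_⟩, ?_⟩
      · simp
        omega
      · simp
        omega
      · simpa only [← hsplit'] using hw
      · simpa only [← hsplit'] using hwF
      · simp only [← hsplit']

end TwoTails

/-! ### Limits of sequences and minimal languages -/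

section Limits

variable {α : Type v}

/-- Coordinatewise limit along a nonprincipal ultrafilter; finitely many coordinates are attained
simultaneously, at arbitrarily large indices. -/
lemma exists_limit [Finite α] {ι : Type*} (f : ℕ → ι → α) :
    ∃ g : ι → α, ∀ (s : Finset ι) (m : ℕ), ∃ n ≥ m, ∀ i ∈ s, f n i = g i := by
  have h : ∀ i, ∃ a, ∀ᶠ n in (Filter.hyperfilter ℕ : Filter ℕ), f n i = a := fun i => by
    obtain ⟨a, -, ha⟩ := (Ultrafilter.eventually_exists_mem_iff (f := Filter.hyperfilter ℕ)
      (P := fun a n => f n i = a) Set.finite_univ).1 (Filter.Eventually.of_forall fun n => by simp)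
    exact ⟨a, ha⟩
  choose g hg using h
  refine ⟨g, fun s m => ?_⟩
  have h1 : ∀ᶠ n in (Filter.hyperfilter ℕ : Filter ℕ), ∀ i ∈ s, f n i = g i :=
    (Filter.eventually_all_finset s).2 fun i _ => hg i
  have h2 : ∀ᶠ n in (Filter.hyperfilter ℕ : Filter ℕ), m ≤ n :=
    Nat.hyperfilter_le_atTop (Filter.eventually_ge_atTop m)
  obtain ⟨n, hn1, hn2⟩ := (h1.and h2).exists
  exact ⟨n, hn2, hn1⟩

/-- A minimal infinite factorial language. -/
lemma exists_minimal_language [Finite α] {L : Set (List α)} (hL : IsFactorial L)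
    (hinf : ∀ n, ∃ w ∈ L, w.length = n) :
    ∃ M ⊆ L, IsFactorial M ∧ (∀ n, ∃ w ∈ M, w.length = n) ∧
      ∀ M' ⊆ M, IsFactorial M' → (∀ n, ∃ w ∈ M', w.length = n) → M ⊆ M' := by
  obtain ⟨M, ⟨⟨hML, hM, hMinf⟩, hmin⟩⟩ := zorn_superset
    {M : Set (List α) | M ⊆ L ∧ IsFactorial M ∧ ∀ n, ∃ w ∈ M, w.length = n} (by
      intro c hc hchain
      rcases c.eq_empty_or_nonempty with rfl | ⟨s₀, hs₀⟩
      · exact ⟨L, ⟨subset_rfl, hL, hinf⟩, by simp⟩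
      refine ⟨⋂₀ c, ⟨(Set.sInter_subset_of_mem hs₀).trans (hc hs₀).1, ?_, fun n => ?_⟩,
        fun s hs => Set.sInter_subset_of_mem hs⟩
      · exact fun w hw v hv s hs => (hc hs).2.1 w (hw s hs) v hv
      · let φ : c → ℕ := fun s => {w | w ∈ s.1 ∧ w.length = n}.ncard
        have : Nonempty c := ⟨⟨s₀, hs₀⟩⟩
        -- A member of the chain with fewest words of length `n` has its words of length `n` in
        -- every other member.
        let s := Function.argmin φ
        obtain ⟨w, hw, hwn⟩ := (hc s.2).2.2 n
        refine ⟨w, fun t ht => ?_, hwn⟩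
        rcases hchain.total s.2 ht with h | h
        · exact h hw
        · have heq := Set.eq_of_subset_of_ncard_le
            (s := {w | w ∈ t ∧ w.length = n}) (t := {w | w ∈ s.1 ∧ w.length = n})
            (fun w hw => ⟨h hw.1, hw.2⟩) (Function.argmin_le φ ⟨t, ht⟩) (finite_words_length_eq _ n)
          exact (heq.symm ▸ (⟨hw, hwn⟩ : w ∈ {w | w ∈ s.1 ∧ w.length = n}) :
            w ∈ {w | w ∈ t ∧ w.length = n}).1)
  exact ⟨M, hML, hM, hMinf, fun M' hM' hf hi => hmin ⟨hM'.trans hML, hf, hi⟩ hM'⟩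

lemma exists_uniformly_recurrent [Finite α] {L : Set (List α)} (hL : IsFactorial L)
    (hinf : ∀ n, ∃ w ∈ L, w.length = n) :
    ∃ z : ℕ → α, (GWord.right z).factors ⊆ L ∧ ∀ v ∈ (GWord.right z).factors, ∃ N : ℕ,
      ∀ w ∈ (GWord.right z).factors, N ≤ w.length → v <:+: w := by
  obtain ⟨M, hML, hM, hMinf, hmin⟩ := exists_minimal_language hL hinf
  choose w hw hwl using hMinf
  obtain ⟨a₀⟩ : Nonempty α := ⟨(w 1)[0]'(by rw [hwl]; omega)⟩
  obtain ⟨z, hz⟩ := exists_limit fun n i : ℕ => (w n).getD i a₀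
  have hzM : (GWord.right z).factors ⊆ M := by
    rintro _ ⟨p, k, rfl⟩
    obtain ⟨n, hn, h⟩ := hz (Finset.range (p + k)) (p + k)
    have : window z p k = ((w n).drop p).take k := by
      refine List.ext_getElem (by simp [hwl]; omega) fun i h1 h2 => ?_
      rw [length_window] at h1
      have := h (p + i) (by simp; omega)
      rw [List.getD_eq_getElem _ _ (by rw [hwl]; omega)] at this
      simp [this]
    rw [this]
    exact hM _ (hw n) _ (take_drop_infix _ _ _)
  have hMz : M = (GWord.right z).factors :=
    (hmin _ hzM (isFactorial_right z) fun n => ⟨window z 0 n, ⟨0, n, rfl⟩, by simp⟩).antisymm hzM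
  refine ⟨z, hzM.trans hML, ?_⟩
  rw [← hMz]
  intro v hv
  by_contra! hN
  -- If arbitrarily long words avoided `v`, the words avoiding `v` would form a smaller infinite
  -- factorial language.
  have := hmin {w | w ∈ M ∧ ¬ v <:+: w} (fun w hw => hw.1)
    (fun w hw v' hv' => ⟨hM w hw.1 v' hv', fun h => hw.2 (h.trans hv')⟩) fun n => by
      obtain ⟨w, hw, hn, hvw⟩ := hN n
      exact ⟨w.take n, ⟨hM w hw _ (List.take_prefix _ _).isInfix,
        fun h => hvw (h.trans (List.take_prefix _ _).isInfix)⟩, by simpa using hn⟩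
  exact (this hv).2 List.infix_rfl

lemma exists_window_eq_of_uniform {z : ℕ → α} (hz : ∀ v ∈ (GWord.right z).factors, ∃ N : ℕ,
    ∀ w ∈ (GWord.right z).factors, N ≤ w.length → v <:+: w) {v : List α}
    (hv : v ∈ (GWord.right z).factors) (N : ℕ) : ∃ p ≥ N, window z p v.length = v := by
  obtain ⟨M, hM⟩ := hz v hv
  obtain ⟨i, hi, h⟩ := isInfix_iff_take_drop.1 (hM (window z N M) ⟨N, M, rfl⟩ (by simp))
  rw [length_window] at hi
  rw [take_drop_window _ _ _ _ _ hi] at h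
  exact ⟨N + i, by omega, h⟩

lemma isUniformlyRecurrent_right {z : ℕ → α} (hz : ∀ v ∈ (GWord.right z).factors, ∃ N : ℕ,
    ∀ w ∈ (GWord.right z).factors, N ≤ w.length → v <:+: w) :
    (GWord.right z).IsUniformlyRecurrent :=
  ⟨fun _ hv N => exists_window_eq_of_uniform hz hv N, hz⟩

lemma isUniformlyRecurrent_left {z : ℕ → α} (hz : ∀ v ∈ (GWord.right z).factors, ∃ N : ℕ,
    ∀ w ∈ (GWord.right z).factors, N ≤ w.length → v <:+: w) :
    (GWord.left z).IsUniformlyRecurrent := by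
  refine ⟨fun v hv N => ?_, fun v hv => ?_⟩
  · obtain ⟨p, hp, h⟩ := exists_window_eq_of_uniform hz (mem_left_factors_iff.1 hv) N
    rw [List.length_reverse] at h
    exact ⟨p, hp, by rw [h, List.reverse_reverse]⟩
  · obtain ⟨N, hN⟩ := hz _ (mem_left_factors_iff.1 hv)
    exact ⟨N, fun w hw hl => by
      simpa using hN _ (mem_left_factors_iff.1 hw) (by simpa using hl)⟩

end Limits

/-! ### A left-periodic point -/

section Asymptotic

variable {α : Type v} {L : Set (List α)}

/-- Without such a pair, a word of `L` would be determined by its first `n` and last `n` letters: a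
first difference elsewhere has `n` common letters before it and `n` letters after it. The growth
would then be bounded. -/
lemma exists_special_pair [Finite α] (hL : IsFactorial L) (hb : ¬ HasBoundedGrowth L) (n : ℕ) :
    ∃ w ∈ L, ∃ w' ∈ L, w.length = 2 * n + 1 ∧ w'.length = 2 * n + 1 ∧ w.take n = w'.take n ∧
      w[n]? ≠ w'[n]? := by
  classical
  by_contra! hno
  apply hb
  let T : Set (List α × List α) := {q | q.1.length ≤ n ∧ q.2.length ≤ n}
  have hB := List.finite_length_le α n
  have hT : T.Finite := (hB.prod hB).subset fun q hq => ⟨hq.1, hq.2⟩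
  refine ⟨T.ncard, fun N => ?_⟩
  refine Set.ncard_le_ncard_of_injOn (fun w => (w.take n, w.drop (N - n))) ?_ ?_ hT
  · rintro w ⟨-, hw⟩
    exact ⟨by simp, by simp; omega⟩
  · rintro w ⟨hw, hwN⟩ w' ⟨hw', hwN'⟩ h
    rw [Prod.mk.injEq] at h
    obtain ⟨h1, h2⟩ := h
    by_contra hne
    have hex : ∃ i : ℕ, w[i]? ≠ w'[i]? := by
      by_contra! hall
      exact hne (List.ext_getElem? hall)
    set i := Nat.find hex
    have hi : w[i]? ≠ w'[i]? := Nat.find_spec hex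
    have hmin : ∀ j < i, w[j]? = w'[j]? := fun j hj => not_not.1 (Nat.find_min hex hj)
    have hin : n ≤ i := by
      by_contra! hlt
      have := congrArg (fun l => l[i]?) h1
      simp only [List.getElem?_take, hlt, if_true] at this
      exact hi this
    have hiN : i < N - n := by
      by_contra! hlt
      have := congrArg (fun l => l[i - (N - n)]?) h2
      simp only [List.getElem?_drop] at this
      rw [Nat.add_sub_cancel' hlt] at this
      exact hi this
    refine hi ?_
    have := hno ((w.drop (i - n)).take (2 * n + 1)) (hL _ hw _ (take_drop_infix _ _ _))
      ((w'.drop (i - n)).take (2 * n + 1)) (hL _ hw' _ (take_drop_infix _ _ _))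
      (by simp; omega) (by simp; omega) ?_
    · simp only [List.getElem?_take, List.getElem?_drop] at this
      rwa [if_pos (by omega), if_pos (by omega), Nat.sub_add_cancel hin] at this
    · refine List.ext_getElem? fun j => ?_
      simp only [List.getElem?_take, List.getElem?_drop]
      split_ifs
      · exact hmin _ (by omega)
      · rfl
      · rfl

lemma windowZ_eq_take_drop {g : ℤ → α} {w : List α} {p : ℤ} {n k : ℕ} {a₀ : α}
    (h : ∀ i ∈ Finset.Ico p (p + k), w.getD (i + n).toNat a₀ = g i) (hp : 0 ≤ p + n)
    (hk : p + n + k ≤ w.length) : windowZ g p k = (w.drop (p + n).toNat).take k := by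
  refine List.ext_getElem (by simp; omega) fun i h1 h2 => ?_
  rw [length_windowZ] at h1
  rw [getElem_windowZ, ← h _ (by simp; omega), List.getD_eq_getElem _ _ (by omega)]
  simp only [List.getElem_take, List.getElem_drop]
  congr 1
  omega

lemma exists_asymptotic_pair [Finite α] (hL : IsFactorial L) (hb : ¬ HasBoundedGrowth L) :
    ∃ x y : ℤ → α, (GWord.two x).factors ⊆ L ∧ (GWord.two y).factors ⊆ L ∧
      (∀ i < 0, x i = y i) ∧ x 0 ≠ y 0 := by
  choose w hw w' hw' hl hl' htake hne using exists_special_pair hL hb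
  obtain ⟨a₀⟩ : Nonempty α := ⟨(w 0)[0]'(by rw [hl]; omega)⟩
  -- The words are centered at their index `n`, where they differ. The default letter `a₀` never
  -- matters, since any fixed finite set of positions is inside the words for large `n`.
  obtain ⟨g, hg⟩ := exists_limit fun (n : ℕ) (i : ℤ) =>
    ((w n).getD (i + n).toNat a₀, (w' n).getD (i + n).toNat a₀)
  refine ⟨fun i => (g i).1, fun i => (g i).2, ?_, ?_, fun i hi => ?_, ?_⟩
  · rintro _ ⟨p, k, rfl⟩
    obtain ⟨n, hn, h⟩ := hg (Finset.Ico p (p + k)) (p.natAbs + k)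
    rw [windowZ_eq_take_drop (w := w n) (n := n) (a₀ := a₀) (fun i hi => congrArg Prod.fst (h i hi))
      (by omega) (by rw [hl]; omega)]
    exact hL _ (hw n) _ (take_drop_infix _ _ _)
  · rintro _ ⟨p, k, rfl⟩
    obtain ⟨n, hn, h⟩ := hg (Finset.Ico p (p + k)) (p.natAbs + k)
    rw [windowZ_eq_take_drop (w := w' n) (n := n) (a₀ := a₀)
      (fun i hi => congrArg Prod.snd (h i hi)) (by omega) (by rw [hl']; omega)]
    exact hL _ (hw' n) _ (take_drop_infix _ _ _)
  · obtain ⟨n, hn, h⟩ := hg {i} i.natAbs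
    have h := h i (by simp)
    have ht := congrArg (fun l => l[(i + n).toNat]?) (htake n)
    simp only [List.getElem?_take] at ht
    rw [if_pos (by omega), if_pos (by omega)] at ht
    dsimp only
    rw [← h]
    simp only [List.getD_eq_getElem?_getD, ht]
  · obtain ⟨n, hn, h⟩ := hg {0} 0
    have h := h 0 (by simp)
    dsimp only
    rw [← h]
    intro h'
    apply hne n
    simp only [zero_add, Int.toNat_natCast] at h'
    rw [List.getD_eq_getElem _ _ (by rw [hl]; omega),
      List.getD_eq_getElem _ _ (by rw [hl']; omega)] at h'
    rw [List.getElem?_eq_getElem (by rw [hl]; omega), List.getElem?_eq_getElem (by rw [hl']; omega),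
      h']

/-- A point with a long periodic run ending at the origin. -/
lemma exists_run_with_break {x y : ℤ → α} (hx : (GWord.two x).factors ⊆ L)
    (hy : (GWord.two y).factors ⊆ L) (hxy : ∀ i < 0, x i = y i) (h0 : x 0 ≠ y 0) {d k : ℕ}
    (hd : 0 < d) {a : ℤ} (ha : a + (k + d) ≤ 0)
    (hper : ∀ i : ℕ, i < k → x (a + i + d) = x (a + i)) :
    ∃ t : ℤ → α, (GWord.two t).factors ⊆ L ∧
      (∀ i : ℤ, -k ≤ i → i + d < 0 → t (i + d) = t i) ∧ t 0 ≠ t (-d) := by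
  classical
  -- The period cannot reach 0 in both points, because `x (-d) = y (-d)` while `x 0 ≠ y 0`.
  have hex : ∃ j : ℕ, x (a + j + d) ≠ x (a + j) ∨ y (a + j + d) ≠ y (a + j) := by
    refine ⟨(-a - d).toNat, ?_⟩
    rw [show a + (-a - d).toNat + d = 0 by omega, show a + (-a - d).toNat = -(d : ℤ) by omega]
    by_contra! h
    exact h0 (h.1.trans ((hxy _ (by omega)).trans h.2.symm))
  set j := Nat.find hex
  have hj : x (a + j + d) ≠ x (a + j) ∨ y (a + j + d) ≠ y (a + j) := Nat.find_spec hex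
  have hmin : ∀ i < j, x (a + i + d) = x (a + i) ∧ y (a + i + d) = y (a + i) := fun i hi => by
    simpa using Nat.find_min hex hi
  have hkj : k ≤ j := by
    by_contra! hlt
    have h := hper j hlt
    rcases hj with h' | h'
    · exact h' h
    · rw [← hxy _ (by omega), ← hxy _ (by omega)] at h'
      exact h' h
  have main : ∀ t : ℤ → α, (GWord.two t).factors ⊆ L → (∀ i < j, t (a + i + d) = t (a + i)) →
      t (a + j + d) ≠ t (a + j) → ∃ t : ℤ → α, (GWord.two t).factors ⊆ L ∧
      (∀ i : ℤ, -k ≤ i → i + d < 0 → t (i + d) = t i) ∧ t 0 ≠ t (-d) := by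
    intro t ht hmin hne
    -- The shift moves the first break to the origin.
    refine ⟨fun i => t (i + (a + j + d)), ?_, fun i hi hi' => ?_, ?_⟩
    · rintro _ ⟨p, n, rfl⟩
      refine ht ⟨p + (a + j + d), n, windowZ_eq_windowZ_iff.2 fun i _ => ?_⟩
      congr 1
      ring
    · have := hmin (i + j + d).toNat (by omega)
      dsimp only
      rw [show i + d + (a + j + d) = a + (i + j + d).toNat + d by omega, this]
      congr 1
      omega
    · dsimp only
      rwa [zero_add, show -(d : ℤ) + (a + j + d) = a + j by ring]
  rcases hj with h | h
  · exact main x hx (fun i hi => (hmin i hi).1) h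
  · exact main y hy (fun i hi => (hmin i hi).2) h

theorem exists_left_periodic [Finite α] (hL : IsFactorial L) (hb : ¬ HasBoundedGrowth L)
    (hur : ∀ z : ℕ → α, (GWord.right z).factors ⊆ L →
      (∀ v ∈ (GWord.right z).factors, ∃ N : ℕ,
        ∀ w ∈ (GWord.right z).factors, N ≤ w.length → v <:+: w) →
      ∃ d : ℕ, 0 < d ∧ ∀ i, z (i + d) = z i) :
    ∃ (y : ℤ → α) (d : ℕ), 0 < d ∧ (GWord.two y).factors ⊆ L ∧
      (∀ i : ℤ, i + d < 0 → y (i + d) = y i) ∧ y 0 ≠ y (-d) := by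
  obtain ⟨x, y, hx, hy, hxy, h0⟩ := exists_asymptotic_pair hL hb
  -- Only the part of `x` left of the origin is used, so that the periodic runs found lie where `x`
  -- and `y` agree.
  let L₀ : Set (List α) := {w | ∃ (p : ℤ) (n : ℕ), p + n ≤ 0 ∧ w = windowZ x p n}
  have hL₀ : IsFactorial L₀ := by
    rintro _ ⟨p, n, hpn, rfl⟩ v hv
    obtain ⟨i, hi, h⟩ := isInfix_iff_take_drop.1 hv
    rw [length_windowZ] at hi
    rw [take_drop_windowZ _ _ _ _ _ hi] at h
    exact ⟨_, _, by omega, h.symm⟩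
  obtain ⟨z, hzL, hz⟩ := exists_uniformly_recurrent hL₀ fun n =>
    ⟨windowZ x (-n) n, ⟨-n, n, by omega, rfl⟩, by simp⟩
  have hL₀L : L₀ ⊆ L := by
    rintro _ ⟨p, n, -, rfl⟩
    exact hx ⟨p, n, rfl⟩
  obtain ⟨d, hd, hper⟩ := hur z (hzL.trans hL₀L) hz
  have hrun : ∀ k : ℕ, ∃ t : ℤ → α, (GWord.two t).factors ⊆ L ∧
      (∀ i : ℤ, -k ≤ i → i + d < 0 → t (i + d) = t i) ∧ t 0 ≠ t (-d) := by
    intro k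
    obtain ⟨a, n, han, h⟩ := hzL ⟨0, k + d, rfl⟩
    have hn : k + d = n := by simpa using congrArg List.length h
    subst hn
    have hget : ∀ i < k + d, z i = x (a + i) := fun i hi => by
      have := List.getElem_of_eq h (i := i) (by simpa using hi)
      simpa using this
    refine exists_run_with_break hx hy hxy h0 hd (a := a) (by exact_mod_cast han) fun i hi => ?_
    rw [← hget i (by omega), ← hper i, hget (i + d) (by omega)]
    congr 1
    push_cast
    ring
  choose t htL htper ht0 using hrun
  obtain ⟨g, hg⟩ := exists_limit t
  refine ⟨g, d, hd, ?_, fun i hi => ?_, ?_⟩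
  · rintro _ ⟨p, k, rfl⟩
    obtain ⟨n, -, h⟩ := hg (Finset.Ico p (p + k)) 0
    refine htL n ⟨p, k, windowZ_eq_windowZ_iff.2 fun i hi => (h _ ?_).symm⟩
    simp
    omega
  · obtain ⟨n, hn, h⟩ := hg {i, i + d} i.natAbs
    rw [← h i (by simp), ← h (i + d) (by simp), htper n i (by omega) hi]
  · obtain ⟨n, -, h⟩ := hg {0, -(d : ℤ)} 0
    rw [← h 0 (by simp), ← h (-d) (by simp)]
    exact ht0 n

theorem exists_right_periodic [Finite α] (hL : IsFactorial L) (hb : ¬ HasBoundedGrowth L)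
    (hur : ∀ z : ℕ → α, (GWord.left z).factors ⊆ L →
      (∀ v ∈ (GWord.right z).factors, ∃ N : ℕ,
        ∀ w ∈ (GWord.right z).factors, N ≤ w.length → v <:+: w) →
      ∃ d : ℕ, 0 < d ∧ ∀ i, z (i + d) = z i) :
    ∃ (q : ℤ → α) (e : ℕ), 0 < e ∧ (GWord.two q).factors ⊆ L ∧
      (∀ i : ℤ, 0 < i → q (i + e) = q i) ∧ q 0 ≠ q e := by
  obtain ⟨y, e, he, hyL, hy, hy0⟩ := exists_left_periodic (L := {w | w.reverse ∈ L}) hL.reverse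
    (fun ⟨B, hB⟩ => hb ⟨B, fun n => growth_reverse L n ▸ hB n⟩) fun z hz hz' =>
      hur z (fun w hw => by simpa using hz (mem_left_factors_iff.1 hw)) hz'
  refine ⟨fun i => y (-i), e, he, ?_, fun i hi => ?_, by simpa using hy0⟩
  · rintro _ ⟨p, n, rfl⟩
    have : windowZ (fun i => y (-i)) p n = (windowZ y (-(p + n - 1)) n).reverse := by
      refine List.ext_getElem (by simp) fun i h1 h2 => ?_
      rw [length_windowZ] at h1
      rw [getElem_windowZ, List.getElem_reverse, getElem_windowZ, length_windowZ]
      congr 1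
      omega
    rw [this]
    exact hyL ⟨_, _, rfl⟩
  · have := hy (-i - e) (by omega)
    dsimp only
    rw [show -(i + e : ℤ) = -i - e by ring, ← this]
    congr 1
    ring

end Asymptotic

/-! ### A word with two periodic tails in a language of unbounded growth -/

section Matching

variable {α : Type v} {L : Set (List α)}

/-- Windows that see the break at different offsets are distinct, so `y` supplies `n - d` of them
and `q` supplies `n - e`. As `L` has at most `n + C` words of length `n`, many coincide. The bound
on `n - i` limits how far the matched window extends right of 0 in `y`; `j + t ≤ n` guarantees `t`
letters from the origin on in `q`. -/
lemma exists_matching_windows [Finite α] {C : ℕ}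
    (hC : ∀ n, growth L n ≤ n + C) {y q : ℤ → α} {d e : ℕ}
    (hy : (GWord.two y).factors ⊆ L) (hyper : ∀ i : ℤ, i + d < 0 → y (i + d) = y i)
    (hy0 : y 0 ≠ y (-d)) (hd : 0 < d) (hq : (GWord.two q).factors ⊆ L)
    (hqper : ∀ i : ℤ, 0 < i → q (i + e) = q i) (hq0 : q 0 ≠ q e) (t : ℕ) :
    ∃ n i j : ℕ, n ≤ i + (C + e + t + 1) ∧ i < n ∧ j + t ≤ n ∧
      windowZ y (-i) n = windowZ q (-j) n := by
  set K := C + e + t + 1 with hK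
  -- With this `n` the condition `n ≤ i + K` reads `d ≤ i`, and at least `t + 1` words are common.
  -- Fewer than that come from offsets `j` with `j + t > n`.
  set n := K + d with hn
  by_contra! hno
  let A := (fun i : ℕ => windowZ y (-i) n) '' Finset.Ico d n
  let B := (fun j : ℕ => windowZ q (-j) n) '' Finset.Ico 0 (n - e)
  have hAn : A.ncard = n - d := by
    rw [Set.InjOn.ncard_image, Set.ncard_coe_finset, Nat.card_Ico]
    have key : ∀ i i' : ℕ, d ≤ i → i < i' → i' < n →
        windowZ y (-i) n ≠ windowZ y (-i') n := by
      intro i i' hi hlt hi' h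
      rw [windowZ_eq_windowZ_iff] at h
      have h1 := h i (by omega)
      have h2 := h (i - d) (by omega)
      have h3 := hyper (-i' + i - d) (by omega)
      rw [Nat.cast_sub hi, show -(i : ℤ) + (i - d) = -d by ring,
        show -(i' : ℤ) + (i - d) = -i' + i - d by ring] at h2
      rw [neg_add_cancel] at h1
      rw [sub_add_cancel] at h3
      exact hy0 (h1.trans (h3.trans h2.symm))
    intro i hi i' hi' h
    simp only [Finset.coe_Ico, Set.mem_Ico] at hi hi'
    rcases lt_trichotomy i i' with hlt | heq | hlt
    · exact (key i i' hi.1 hlt hi'.2 h).elim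
    · exact heq
    · exact (key i' i hi'.1 hlt hi.2 h.symm).elim
  have hBn : B.ncard = n - e := by
    rw [Set.InjOn.ncard_image, Set.ncard_coe_finset, Nat.card_Ico, Nat.sub_zero]
    have key : ∀ j j' : ℕ, j < j' → j' < n - e → windowZ q (-j) n ≠ windowZ q (-j') n := by
      intro j j' hlt hj' h
      rw [windowZ_eq_windowZ_iff] at h
      have h1 := h j' (by omega)
      have h2 := h (j' + e) (by omega)
      have h3 := hqper (-j + j') (by omega)
      rw [Nat.cast_add, ← add_assoc, ← add_assoc, neg_add_cancel, zero_add] at h2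
      rw [neg_add_cancel] at h1
      exact hq0 (h1.symm.trans (h3.symm.trans h2))
    intro j hj j' hj' h
    simp only [Finset.coe_Ico, Set.mem_Ico] at hj hj'
    rcases lt_trichotomy j j' with hlt | heq | hlt
    · exact (key j j' hlt hj'.2 h).elim
    · exact heq
    · exact (key j' j hlt hj.2 h.symm).elim
  have hAfin : A.Finite := (Finset.finite_toSet _).image _
  have hBfin : B.Finite := (Finset.finite_toSet _).image _
  have hunion : (A ∪ B).ncard ≤ n + C := by
    refine (Set.ncard_le_ncard ?_ (finite_words_length_eq (· ∈ L) n)).trans (hC n)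
    rintro _ (⟨i, -, rfl⟩ | ⟨j, -, rfl⟩)
    exacts [⟨hy ⟨_, _, rfl⟩, by simp⟩, ⟨hq ⟨_, _, rfl⟩, by simp⟩]
  have hinter : A ∩ B ⊆ (fun i : ℕ => windowZ y (-i) n) '' Finset.Ico d (n - K) ∪
      (fun j : ℕ => windowZ q (-j) n) '' Finset.Ico (n + 1 - t) n := by
    rintro w ⟨⟨i, hi, hiw⟩, j, hj, hjw⟩
    simp only [Finset.coe_Ico, Set.mem_Ico] at hi hj
    dsimp only at hiw hjw
    by_cases h1 : i < n - K
    · exact Or.inl ⟨i, by simp; omega, hiw⟩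
    by_cases h2 : n < j + t
    · exact Or.inr ⟨j, by simp; omega, hjw⟩
    · exact (hno n i j (by omega) hi.2 (by omega) (hiw.trans hjw.symm)).elim
  have hle := (Set.ncard_le_ncard hinter (((Finset.finite_toSet _).image _).union
    ((Finset.finite_toSet _).image _))).trans (Set.ncard_union_le _ _)
  have h1 := Set.ncard_image_le (f := fun i : ℕ => windowZ y (-i) n)
    (Finset.finite_toSet (Finset.Ico d (n - K)))
  have h2 := Set.ncard_image_le (f := fun j : ℕ => windowZ q (-j) n)
    (Finset.finite_toSet (Finset.Ico (n + 1 - t) n))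
  rw [Set.ncard_coe_finset, Nat.card_Ico] at h1 h2
  have h3 := Set.ncard_union_add_ncard_inter A B hAfin hBfin
  omega

/-- On a matched window `y` copies the periodic part of `q` from a position at most `C + e + 1` on,
a bound independent of `t`; taking `t` large covers any given `r`. -/
lemma eventually_periodic_of_matching [Finite α] {C : ℕ}
    (hC : ∀ n, growth L n ≤ n + C) {y q : ℤ → α}
    {d e : ℕ} (hy : (GWord.two y).factors ⊆ L) (hyper : ∀ i : ℤ, i + d < 0 → y (i + d) = y i)
    (hy0 : y 0 ≠ y (-d)) (hd : 0 < d) (hq : (GWord.two q).factors ⊆ L)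
    (hqper : ∀ i : ℤ, 0 < i → q (i + e) = q i) (hq0 : q 0 ≠ q e) (he : 0 < e) :
    ∀ r : ℤ, C + e + 1 < r → y (r + e) = y r := by
  intro r hr
  obtain ⟨n, i, j, h1, h2, h3, h⟩ := exists_matching_windows hC hy hyper hy0 hd hq hqper hq0
    (r + 2 * e + d + 1).toNat
  rw [windowZ_eq_windowZ_iff] at h
  have hmatch : ∀ s : ℤ, -i ≤ s → s < n - i → y s = q (s + i - j) := by
    intro s hs hs'
    have := h (s + i).toNat (by omega)
    rw [Int.toNat_of_nonneg (by omega)] at this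
    rw [show s = -i + (s + i) by ring, this]
    congr 1
    ring
  have hper : ∀ s : ℤ, j - i < s → s + e < n - i → y (s + e) = y s := by
    intro s hs hs'
    rw [hmatch _ (by omega) hs', hmatch s (by omega) (by omega), ← hqper (s + i - j) (by omega)]
    congr 1
    ring
  -- Otherwise the copied period `e` would extend left of `-e - d` and, together with the left
  -- period `d`, would force `y 0 = y (-d)`.
  have hij : (i : ℤ) ≤ j + e + d := by
    by_contra! hlt
    have e1 := hper (-e) (by omega) (by omega)
    have e2 := hper (-e - d) (by omega) (by omega)
    have e3 := hyper (-e - d) (by omega)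
    rw [neg_add_cancel] at e1
    rw [show (-e - d + e : ℤ) = -d by ring] at e2
    rw [sub_add_cancel] at e3
    exact hy0 (e1.trans (e3.trans e2.symm))
  exact hper r (by omega) (by omega)

lemma exists_eq_twoTails {y : ℤ → α} {d e m : ℕ} (hd : 0 < d) (he : 0 < e)
    (hleft : ∀ i : ℤ, i + d < 0 → y (i + d) = y i) (hy0 : y 0 ≠ y (-d))
    (hright : ∀ r : ℤ, m ≤ r → y (r + e) = y r) :
    ∃ (u c v : List α) (hu : u ≠ []) (hv : v ≠ []), y = twoTails u c v hu hv ∧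
      twoTails u c v hu hv ≠ twoPeriodic u hu := by
  have hu : windowZ y (-d) d ≠ [] := by
    rw [← List.length_pos_iff]
    simpa
  have hv : windowZ y m e ≠ [] := by
    rw [← List.length_pos_iff]
    simpa
  have hl : Function.Periodic (fun k : ℕ => y (-(k + 1 : ℤ))) d := fun k => by
    dsimp only
    rw [← hleft (-((k + d : ℕ) + 1 : ℤ)) (by omega)]
    congr 1
    push_cast
    ring
  have hr : Function.Periodic (fun k : ℕ => y (m + k)) e := fun k => by
    dsimp only
    rw [← hright (m + k) (by omega)]
    congr 1
    push_cast
    ring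
  have heq : y = twoTails (windowZ y (-d) d) (windowZ y 0 m) (windowZ y m e) hu hv := by
    ext i
    rcases lt_or_ge i 0 with hi | hi
    · obtain ⟨k, rfl⟩ : ∃ k : ℕ, i = -(k + 1 : ℤ) := ⟨(-i - 1).toNat, by omega⟩
      rw [twoTails, glue_neg]
      simp only [repeatLeft, repeatWord, List.getElem_reverse, List.length_reverse,
        getElem_windowZ, length_windowZ]
      refine (hl.map_mod_nat k).symm.trans ?_
      have := Nat.mod_lt k hd
      congr 1
      omega
    · obtain ⟨k, rfl⟩ : ∃ k : ℕ, i = k := ⟨i.toNat, by omega⟩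
      rw [twoTails, glue_natCast, prepend]
      split_ifs with hk
      · simp
      · rw [length_windowZ] at hk
        simp only [repeatWord, getElem_windowZ, length_windowZ]
        refine Eq.trans ?_ (hr.map_mod_nat (k - m)).symm
        congr 1
        omega
  -- The letter of `u^∞` at 0 is the first letter of `u`, which is `y (-d)`.
  refine ⟨_, _, _, hu, hv, heq, fun h => hy0 ?_⟩
  have h0 := congrFun (heq.trans h) 0
  rw [h0, twoPeriodic]
  exact (glue_natCast _ _ 0).trans (by simp [repeatWord])

theorem descriptionOne [Finite α] (hL : IsFactorial L) (hT : IsBoundary L)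
    (hur : ¬ ∃ W : GWord α, IsURNonperiodicIn W L) (hb : ¬ HasBoundedGrowth L) :
    DescriptionOne L := by
  obtain ⟨y, d, hd, hy, hyper, hy0⟩ := exists_left_periodic hL hb fun z hz hz' => by
    by_contra hp
    exact hur ⟨.right z, isUniformlyRecurrent_right hz', hp, hz⟩
  obtain ⟨q, e, he, hq, hqper, hq0⟩ := exists_right_periodic hL hb fun z hz hz' => by
    by_contra hp
    exact hur ⟨.left z, isUniformlyRecurrent_left hz', hp, hz⟩
  obtain ⟨C, hC⟩ := hT
  have hright := eventually_periodic_of_matching hC hy hyper hy0 hd hq hqper hq0 he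
  obtain ⟨u, c, v, hu, hv, rfl, hne⟩ := exists_eq_twoTails (m := C + e + 2) hd he hyper hy0
    fun r hr => hright r (by push_cast at hr; omega)
  exact descriptionOne_of_twoTails hL ⟨C, hC⟩ hne hy

end Matching

end BoundaryLang

/-! ### Assembly of the theorem -/

theorem mainTheorem2 (𝕜 : Type u) [Field 𝕜] {α : Type v} [Finite α] [LinearOrder α]
    (L : Set (List α)) (hL : BoundaryLang.IsFactorial L) (hT : BoundaryLang.IsBoundary L) :
    (∃ (A : Type (max u v)) (_ : Ring A) (_ : Algebra 𝕜 A) (a : α → A),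
      BoundaryLang.IsBoundaryAlgebra 𝕜 a ∧ BoundaryLang.normalWords 𝕜 a = L) ∧
    ((¬ ∃ W : BoundaryLang.GWord α, BoundaryLang.IsURNonperiodicIn W L) →
      (¬ BoundaryLang.HasBoundedGrowth L → BoundaryLang.DescriptionOne L) ∧
      (BoundaryLang.HasBoundedGrowth L → BoundaryLang.DescriptionSlow L)) ∧
    (∀ W : BoundaryLang.GWord α, BoundaryLang.IsURNonperiodicIn W L →
      BoundaryLang.DescriptionTwo W L) :=
  ⟨BoundaryLang.exists_boundary_algebra 𝕜 hL hT,
    fun hur => ⟨BoundaryLang.descriptionOne hL hT hur, BoundaryLang.descriptionSlow hL⟩,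
    fun _ hW => BoundaryLang.descriptionTwo hL hT hW⟩
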